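/- Let $\alpha>0$ and $a>\alpha/2$, and let $\lfloor\alpha\rfloor$ be the greatest integer $\le\alpha$. For complex $s$ with $\operatorname{Re}s>\alpha$ put $$S^*_\alpha(s,a)=\sum_{n=0}^\infty\frac{\binom{n+\alpha-1}{n}}{(n+a)^s},$$ and for $x\in\mathbb R$ put $$\varphi_\alpha(x)=\frac{2^\alpha}{\pi}\int_0^1\cos(x\ln y)\,y^{\alpha-1}\Big(\frac{\ln y}{y^2-1}\Big)^{\alpha}dy .$$ Complex powers are principal values. Then: 1. The integral defining $\varphi_\alpha(x)$ converges absolutely for every $x\in\mathbb R$, $\varphi_\alpha$ is a probability density on $\mathbb R$ (that is, $\varphi_\alpha\ge0$, $\varphi_\alpha$ is integrable and $\int_{\mathbb R}\varphi_\alpha=1$), and $\int_{\mathbb R}e^{itx}\varphi_\alpha(x)\,dx=(t/\sinh t)^\alpha$ for all real $t\neq0$. 2. For $\operatorname{Re}s>\alpha$ the series $S^*_\alpha(s,a)$ converges absolutely, and $$S^*_\alpha(s,a)=\frac{\Gamma(s-\alpha)}{\Gamma(s)}\int_{\mathbb R}\frac{\varphi_\alpha(y)}{(a-\frac\alpha2+\frac12iy)^{s-\alpha}}\,dy=\frac{\Gamma(s-\alpha)}{\Gamma(s)}\,E\Big(a-\frac\alpha2+\frac12iX_\alpha\Big)^{\alpha-s}$$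 for every random variable $X_\alpha$ with density $\varphi_\alpha$. 3. For $\operatorname{Re}s>\lfloor\alpha\rfloor$ the expectation $E(a-\frac\alpha2+\frac12iX_\alpha)^{\alpha-s}$ exists (absolutely), equals the integral in 2, and is an analytic function of $s$. The right-hand side of the identity in 2 is analytic on $\{s:\operatorname{Re}s>\lfloor\alpha\rfloor,\ s\ne\alpha\}$, and it is the only analytic function there that agrees with $S^*_\alpha(s,a)$ for $\operatorname{Re}s>\alpha$; thus the identity extends analytically to this region. As $s\to\alpha$, $s\neq\alpha$, $(s-\alpha)$ times the right-hand side tends to $1/\Gamma(\alpha)$; in particular, for non-integer $\alpha$ the point $s=\alpha$ is a simple pole of the extension. -/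

import Mathlib

open MeasureTheory ProbabilityTheory Filter Topology

noncomputable section

/-- The integrand `cos (x ln y) y^(α-1) (ln y)^α / (y^2 - 1)^α` for `0 < y < 1`. Numerator and
denominator are powers of the negative numbers `ln y` and `y^2 - 1`; their quotient is the power of
the positive number `ln y / (y^2 - 1)`. -/
def sinhDensityIntegrand (α x y : ℝ) : ℝ :=
  Real.cos (x * Real.log y) * y ^ (α - 1) * (Real.log y / (y ^ 2 - 1)) ^ α

/-- The density `φ_α` of the hyperbolic sinh distribution. -/
def sinhDensity (α x : ℝ) : ℝ :=
  2 ^ α / Real.pi * ∫ y in (0 : ℝ)..1, sinhDensityIntegrand α x y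

/-- The law on `ℝ` with Lebesgue density `φ_α`. -/
def sinhLaw (α : ℝ) : Measure ℝ :=
  volume.withDensity (fun x => ENNReal.ofReal (sinhDensity α x))

/-- The `n`-th term `C(n + α - 1, n) / (n + a)^s`, with the generalized binomial coefficient. -/
def sinhMomentTerm (α a : ℝ) (s : ℂ) (n : ℕ) : ℂ :=
  ((Ring.choose ((n : ℝ) + α - 1) n : ℝ) : ℂ) / ((n : ℂ) + (a : ℂ)) ^ s

/-- The hyperbolic sinh-moment function `S*_α(s, a)`, as the sum of its series. -/
def sinhMoment (α a : ℝ) (s : ℂ) : ℂ :=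
  ∑' n : ℕ, sinhMomentTerm α a s n

/-- The integral `∫ φ_α(y) / (a - α/2 + i y / 2)^(s - α) dy` (principal power). -/
def sinhMomentIntegral (α a : ℝ) (s : ℂ) : ℂ :=
  ∫ y : ℝ, 1 / ((a : ℂ) - (α : ℂ) / 2 + 1 / 2 * Complex.I * (y : ℂ)) ^ (s - (α : ℂ)) *
    (sinhDensity α y : ℂ)

end

/-! Write g(t) = t / sinh t, with g(0) = 1 (`sinhQuot`). The substitution y = e^{-t} shows that φ_α
is the inverse Fourier transform of g^α, which decays exponentially.

Positivity is probabilistic. Euler's product writes g as the infinite product of the factors (1 +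
(t/πj)²)⁻¹, j ≥ 1, and the α-th power of each factor is the characteristic function of a scaled
difference of two independent Gamma(α) variables. So g^α is a pointwise limit of characteristic
functions. Inverse transforms of characteristic functions damped by a Gaussian are nonnegative, and
this survives both limits (`sinhDensity_nonneg`). Gaussian damping and Fatou's lemma then make φ_α
integrable, and Fourier inversion gives its characteristic function g^α and its mass 1
(`integral_cexp_mul_sinhDensity`).

For the series, write Γ(s)(n+a)^{-s} as a Gamma integral in u and sum the negative binomial series
under the integral. This produces e^{-au}(1 - e^{-u})^{-α} = u^{-α} e^{-(a-α/2)u} g(u/2)^α.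
Replacing g(u/2)^α by the integral of e^{-iuy/2} φ_α(y) and integrating u out first leaves Γ(s-α)
times the moment integral.

For the continuation, 1 - g^α = O(t²) gives φ_α a finite second moment. That dominates the moment
integrand, locally uniformly in s, for Re s > α - 1, a half plane containing Re s > ⌊α⌋. There
Γ(s-α) has at most the pole s = α, and the punctured half plane is connected, so the identity
theorem gives uniqueness. -/

/-! ### The function t / sinh t: bounds, continuity, Euler product. -/

section SinhQuot

/-- The function `t / sinh t`, continuously extended by `1` at `t = 0`. -/
noncomputable def sinhQuot (t : ℝ) : ℝ := if t = 0 then 1 else t / Real.sinh t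

lemma sinhQuot_zero : sinhQuot 0 = 1 := by simp [sinhQuot]

lemma sinhQuot_of_ne {t : ℝ} (ht : t ≠ 0) : sinhQuot t = t / Real.sinh t := by simp [sinhQuot, ht]

lemma sinhQuot_neg (t : ℝ) : sinhQuot (-t) = sinhQuot t := by
  simp [sinhQuot, Real.sinh_neg, neg_div_neg_eq]

lemma sinhQuot_abs (t : ℝ) : sinhQuot |t| = sinhQuot t := by
  rcases abs_choice t with h | h <;> simp [h, sinhQuot_neg]

lemma sinhQuot_pos (t : ℝ) : 0 < sinhQuot t := by
  rw [← sinhQuot_abs]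
  rcases eq_or_ne t 0 with rfl | ht
  · simp [sinhQuot_zero]
  · have h := abs_pos.2 ht
    rw [sinhQuot_of_ne h.ne']
    exact div_pos h (Real.sinh_pos_iff.2 h)

lemma mul_cosh_half_le_sinh {t : ℝ} (ht : 0 ≤ t) : t * Real.cosh (t / 2) ≤ Real.sinh t := by
  have h : Real.sinh t = 2 * Real.sinh (t / 2) * Real.cosh (t / 2) := by
    rw [← Real.sinh_two_mul]; ring_nf
  have h2 : t / 2 ≤ Real.sinh (t / 2) := Real.self_le_sinh_iff.2 (by positivity)
  have h3 := Real.cosh_pos (t / 2)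
  nlinarith

lemma sinh_le_mul_cosh {t : ℝ} (ht : 0 ≤ t) : Real.sinh t ≤ t * Real.cosh t := by
  have h : MonotoneOn (fun x : ℝ => x * Real.cosh x - Real.sinh x) (Set.Ici 0) := by
    refine monotoneOn_of_deriv_nonneg (convex_Ici 0) (by fun_prop) (by fun_prop) ?_
    intro x hx
    rw [interior_Ici, Set.mem_Ioi] at hx
    have : HasDerivAt (fun x : ℝ => x * Real.cosh x - Real.sinh x)
        (1 * Real.cosh x + x * Real.sinh x - Real.cosh x) x :=
      ((hasDerivAt_id x).mul (Real.hasDerivAt_cosh x)).sub (Real.hasDerivAt_sinh x)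
    rw [this.deriv]
    have := Real.sinh_pos_iff.2 hx
    have := mul_pos hx this
    linarith
  have := h (Set.mem_Ici.2 le_rfl) (Set.mem_Ici.2 ht) ht
  simp at this
  linarith

/-- Combines sinh u ≥ u cosh(u/2) with cosh(u/2) ≥ e^{u/2}/2. This decay makes every positive power
integrable. -/
lemma sinhQuot_le_exp (t : ℝ) : sinhQuot t ≤ 2 * Real.exp (-(|t| / 2)) := by
  rw [← sinhQuot_abs]
  generalize hu : |t| = u
  have hu0 : 0 ≤ u := hu ▸ abs_nonneg t
  rcases hu0.eq_or_lt with rfl | h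
  · simp [sinhQuot_zero]
  · rw [sinhQuot_of_ne h.ne', div_le_iff₀ (Real.sinh_pos_iff.2 h)]
    have h1 := mul_cosh_half_le_sinh h.le
    have h2 : Real.exp (u / 2) / 2 ≤ Real.cosh (u / 2) := by
      rw [Real.cosh_eq]; have := Real.exp_pos (-(u / 2)); linarith
    have h3 : Real.exp (-(u / 2)) * Real.exp (u / 2) = 1 := by rw [← Real.exp_add]; simp
    calc u = 2 * Real.exp (-(u / 2)) * (u * (Real.exp (u / 2) / 2)) := by
            linear_combination -u * h3
      _ ≤ 2 * Real.exp (-(u / 2)) * (u * Real.cosh (u / 2)) := by gcongr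
      _ ≤ _ := by gcongr

lemma sinhQuot_le_one (t : ℝ) : sinhQuot t ≤ 1 := by
  rw [← sinhQuot_abs]
  generalize hu : |t| = u
  have hu0 : 0 ≤ u := hu ▸ abs_nonneg t
  rcases hu0.eq_or_lt with rfl | h
  · simp [sinhQuot_zero]
  · rw [sinhQuot_of_ne h.ne', div_le_one (Real.sinh_pos_iff.2 h)]
    exact Real.self_le_sinh_iff.2 h.le

/-- Follows from sinh u ≤ u cosh u and cosh u ≤ e^{u²/2}. It serves twice: for continuity at 0, and
for the quadratic flatness there that yields the second moment. -/
lemma exp_neg_sq_le_sinhQuot (t : ℝ) : Real.exp (-(t ^ 2 / 2)) ≤ sinhQuot t := by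
  rw [← sinhQuot_abs, ← sq_abs]
  generalize hu : |t| = u
  have hu0 : 0 ≤ u := hu ▸ abs_nonneg t
  rcases hu0.eq_or_lt with rfl | h
  · simp [sinhQuot_zero]
  · rw [sinhQuot_of_ne h.ne', le_div_iff₀ (Real.sinh_pos_iff.2 h), Real.exp_neg,
      inv_mul_le_iff₀ (Real.exp_pos _), mul_comm]
    calc _ ≤ u * Real.cosh u := sinh_le_mul_cosh h.le
      _ ≤ _ := by gcongr; exact Real.cosh_le_exp_half_sq u

lemma continuous_sinhQuot : Continuous sinhQuot := by
  rw [continuous_iff_continuousAt]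
  intro t
  rcases eq_or_ne t 0 with rfl | ht
  · rw [ContinuousAt, sinhQuot_zero]
    refine tendsto_of_tendsto_of_tendsto_of_le_of_le ?_ tendsto_const_nhds
      exp_neg_sq_le_sinhQuot sinhQuot_le_one
    have : Continuous fun t : ℝ => Real.exp (-(t ^ 2 / 2)) := by fun_prop
    simpa using this.tendsto 0
  · have : ContinuousAt (fun t => t / Real.sinh t) t :=
      continuousAt_id.div Real.continuous_sinh.continuousAt (by simpa using ht)
    refine this.congr ?_
    filter_upwards [isOpen_ne.mem_nhds ht] with x hx
    rw [sinhQuot_of_ne hx]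

/-- Euler's product for `t / sinh t`. -/
lemma tendsto_prod_sinhQuot (t : ℝ) :
    Tendsto (fun n : ℕ => ∏ j ∈ Finset.range n, (1 + (t / (Real.pi * (j + 1))) ^ 2)⁻¹) atTop
      (𝓝 (sinhQuot t)) := by
  rcases eq_or_ne t 0 with rfl | ht
  · simp [sinhQuot_zero]
  have hπ := Real.pi_ne_zero
  have htc : (t : ℂ) ≠ 0 := by exact_mod_cast ht
  -- At z = it/π the sine product has factors 1 + (t/(π(j+1)))², and sin(it) = i sinh t; dividing by
  -- it leaves sinh t / t.
  have h := Complex.tendsto_euler_sin_prod (Complex.I * t / Real.pi)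
  have e : (Real.pi : ℂ) * (Complex.I * t / Real.pi) = t * Complex.I := by
    field_simp
  rw [e, Complex.sin_mul_I] at h
  have h2 := h.const_mul ((t : ℂ) * Complex.I)⁻¹
  have h3 : Tendsto (fun n : ℕ => ∏ j ∈ Finset.range n, (1 + (t / (Real.pi * (j + 1))) ^ 2)) atTop
      (𝓝 (Real.sinh t / t)) := by
    have := (Complex.continuous_re.tendsto _).comp h2
    refine (this.congr fun n => ?_).trans_eq ?_
    · simp only [Function.comp]
      rw [← mul_assoc, inv_mul_cancel₀ (mul_ne_zero htc Complex.I_ne_zero), one_mul]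
      rw [← Complex.ofReal_re (∏ j ∈ Finset.range n, (1 + (t / (Real.pi * (j + 1))) ^ 2))]
      congr 1
      push_cast
      refine Finset.prod_congr rfl fun j _ => ?_
      have : (j : ℂ) + 1 ≠ 0 := by exact_mod_cast j.succ_ne_zero
      rw [div_pow, mul_pow, Complex.I_sq]
      field_simp
      ring
    · congr 1
      have : ((t : ℂ) * Complex.I)⁻¹ * (Complex.sinh t * Complex.I) = ((Real.sinh t / t : ℝ) : ℂ) := by
        push_cast
        field_simp
      rw [this, Complex.ofReal_re]
  have h4 := h3.inv₀ (div_ne_zero (by simpa using ht) ht)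
  rw [sinhQuot_of_ne ht, ← inv_div]
  simpa using h4

lemma integrable_exp_neg_mul_abs {c : ℝ} (hc : 0 < c) :
    Integrable fun t : ℝ => Real.exp (-(c * |t|)) := by
  have h1 : IntegrableOn (fun t : ℝ => Real.exp (-(c * |t|))) (Set.Ioi 0) :=
    (integrableOn_exp_mul_Ioi (neg_lt_zero.2 hc) 0).congr_fun
      (fun t ht => by simp [abs_of_pos (Set.mem_Ioi.1 ht)]) measurableSet_Ioi
  have h2 : IntegrableOn (fun t : ℝ => Real.exp (-(c * |t|))) (Set.Iic 0) :=
    (integrableOn_exp_mul_Iic hc 0).congr_fun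
      (fun t ht => by simp [abs_of_nonpos (Set.mem_Iic.1 ht)]) measurableSet_Iic
  rw [← integrableOn_univ, ← Set.Iic_union_Ioi (a := (0 : ℝ))]
  exact h2.union h1

section rpow

variable {α : ℝ}

lemma sinhQuot_rpow_pos (α t : ℝ) : 0 < sinhQuot t ^ α := Real.rpow_pos_of_pos (sinhQuot_pos t) α

lemma sinhQuot_rpow_le_one (hα : 0 < α) (t : ℝ) : sinhQuot t ^ α ≤ 1 :=
  Real.rpow_le_one (sinhQuot_pos t).le (sinhQuot_le_one t) hα.le

lemma continuous_sinhQuot_rpow (α : ℝ) : Continuous fun t => sinhQuot t ^ α :=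
  continuous_sinhQuot.rpow_const fun t => Or.inl (sinhQuot_pos t).ne'

lemma integrable_sinhQuot_rpow (hα : 0 < α) : Integrable fun t => sinhQuot t ^ α := by
  refine ((integrable_exp_neg_mul_abs (c := α / 2) (by positivity)).const_mul (2 ^ α)).mono'
    (continuous_sinhQuot_rpow α).aestronglyMeasurable (ae_of_all _ fun t => ?_)
  rw [Real.norm_of_nonneg (sinhQuot_rpow_pos α t).le]
  calc _ ≤ (2 * Real.exp (-(|t| / 2))) ^ α :=
        Real.rpow_le_rpow (sinhQuot_pos t).le (sinhQuot_le_exp t) hα.le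
    _ = _ := by
        rw [Real.mul_rpow (by norm_num) (Real.exp_pos _).le, ← Real.exp_mul]
        ring_nf

lemma one_sub_sinhQuot_rpow_le (hα : 0 < α) (t : ℝ) : 1 - sinhQuot t ^ α ≤ α * t ^ 2 / 2 := by
  have h1 : Real.exp (-(t ^ 2 / 2)) ^ α ≤ sinhQuot t ^ α :=
    Real.rpow_le_rpow (Real.exp_pos _).le (exp_neg_sq_le_sinhQuot t) hα.le
  rw [← Real.exp_mul] at h1
  have h2 := Real.add_one_le_exp (-(t ^ 2 / 2) * α)
  linarith

end rpow

end SinhQuot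

/-! ### Holomorphic parameter integrals, complex Gamma integrals and Gamma laws. -/

section GammaLaw

/-- An integral of a locally dominated family of holomorphic functions is holomorphic. -/
lemma differentiableAt_integral_of_dominated {X : Type*} [MeasurableSpace X] {μ : Measure X}
    {F : ℂ → X → ℂ} {z₀ : ℂ} {ε : ℝ} (hε : 0 < ε) {bound : X → ℝ}
    (hmeas : ∀ z ∈ Metric.ball z₀ ε, AEStronglyMeasurable (F z) μ)
    (hdiff : ∀ᵐ x ∂μ, DifferentiableOn ℂ (fun z => F z x) (Metric.ball z₀ ε))
    (hbound : ∀ᵐ x ∂μ, ∀ z ∈ Metric.ball z₀ ε, ‖F z x‖ ≤ bound x)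
    (hint : Integrable bound μ) :
    DifferentiableAt ℂ (fun z => ∫ x, F z x ∂μ) z₀ := by
  have hz₀ : z₀ ∈ Metric.ball z₀ ε := Metric.mem_ball_self hε
  have hball : Metric.ball z₀ ε ∈ 𝓝 z₀ := Metric.ball_mem_nhds z₀ hε
  have hε2 : 0 < ε / 2 := by positivity
  have hderiv : ∀ x, DifferentiableOn ℂ (fun z => F z x) (Metric.ball z₀ ε) →
      ∀ z ∈ Metric.ball z₀ ε, HasDerivAt (fun z => F z x) (deriv (fun z => F z x) z) z :=
    fun x hx z hz => (hx.differentiableAt (Metric.isOpen_ball.mem_nhds hz)).hasDerivAt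
  have hmeas' : AEStronglyMeasurable (fun x => deriv (fun z => F z x) z₀) μ := by
    -- The derivative is measurable in x as a pointwise limit of difference quotients along real
    -- increments u n → 0.
    obtain ⟨u, -, hu, hu0⟩ := exists_seq_strictAnti_tendsto' hε
    have hmem : ∀ n, z₀ + (u n : ℂ) ∈ Metric.ball z₀ ε := fun n => by
      have := hu n
      simp [abs_of_pos this.1, this.2]
    refine aestronglyMeasurable_of_tendsto_ae atTop
      (f := fun n x => ((u n : ℂ))⁻¹ • (F (z₀ + (u n : ℂ)) x - F z₀ x))
      (fun n => ((hmeas _ (hmem n)).sub (hmeas _ hz₀)).const_smul ((u n : ℂ)⁻¹)) ?_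
    filter_upwards [hdiff] with x hx
    have h := (hasDerivAt_iff_tendsto_slope_zero.1 (hderiv x hx z₀ hz₀))
    refine h.comp (tendsto_nhdsWithin_iff.2 ⟨?_, Eventually.of_forall fun n => ?_⟩)
    · simpa [Function.comp_def] using (Complex.continuous_ofReal.tendsto 0).comp hu0
    · simpa using (hu n).1.ne'
  refine (hasDerivAt_integral_of_dominated_loc_of_deriv_le (s := Metric.ball z₀ (ε / 2))
    (Metric.ball_mem_nhds z₀ hε2) (bound := fun x => bound x / (ε / 2))
    (F' := fun z x => deriv (fun z => F z x) z)
    (eventually_of_mem hball hmeas) ?_ hmeas' ?_ (hint.div_const _) ?_).2.differentiableAt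
  · exact hint.mono' (hmeas z₀ hz₀) (hbound.mono fun x hx => hx z₀ hz₀)
  · filter_upwards [hdiff, hbound] with x hd hb z hz
    have hsub : Metric.closedBall z (ε / 2) ⊆ Metric.ball z₀ ε := fun w hw => by
      rw [Metric.mem_ball] at hz ⊢
      rw [Metric.mem_closedBall] at hw
      linarith [dist_triangle w z z₀]
    -- Cauchy's estimate on the circle of radius ε/2 about z: a bound on F alone dominates its
    -- derivative on the smaller ball.
    refine Complex.norm_deriv_le_of_forall_mem_sphere_norm_le hε2 ?_
      fun w hw => hb w (hsub (Metric.sphere_subset_closedBall hw))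
    exact (hd.mono hsub).diffContOnCl_ball subset_rfl
  · filter_upwards [hdiff] with x hx z hz
    exact hderiv x hx z (Metric.ball_subset_ball (by linarith) hz)

lemma integrableOn_rpow_mul_exp_neg_mul {s b : ℝ} (hs : -1 < s) (hb : 0 < b) :
    IntegrableOn (fun x : ℝ => x ^ s * Real.exp (-(b * x))) (Set.Ioi 0) := by
  have := integrableOn_rpow_mul_exp_neg_mul_rpow hs one_pos hb
  simpa [neg_mul] using this

lemma norm_cpow_mul_exp_neg_mul {t : ℝ} (ht : 0 < t) (a r : ℂ) :
    ‖(t : ℂ) ^ (a - 1) * Complex.exp (-(r * t))‖ = t ^ (a.re - 1) * Real.exp (-(r.re * t)) := by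
  rw [norm_mul, Complex.norm_cpow_eq_rpow_re_of_pos ht, Complex.norm_exp]
  simp

lemma aestronglyMeasurable_cpow_mul_exp_neg_mul (a r : ℂ) :
    AEStronglyMeasurable (fun t : ℝ => (t : ℂ) ^ (a - 1) * Complex.exp (-(r * t)))
      (volume.restrict (Set.Ioi 0)) := by
  refine ContinuousOn.aestronglyMeasurable (fun t ht => ?_) measurableSet_Ioi
  have : (t : ℂ) ∈ Complex.slitPlane := Or.inl (by simpa using ht)
  refine ContinuousAt.continuousWithinAt ?_
  exact ((continuousAt_cpow_const this).comp Complex.continuous_ofReal.continuousAt).mul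
    (by fun_prop)

lemma integrableOn_cpow_mul_exp_neg_mul {a r : ℂ} (ha : 0 < a.re) (hr : 0 < r.re) :
    IntegrableOn (fun t : ℝ => (t : ℂ) ^ (a - 1) * Complex.exp (-(r * t))) (Set.Ioi 0) := by
  refine (integrableOn_rpow_mul_exp_neg_mul (s := a.re - 1) (by linarith) hr).mono'
    (aestronglyMeasurable_cpow_mul_exp_neg_mul a r) ?_
  filter_upwards [ae_restrict_mem measurableSet_Ioi] with t ht
  exact (norm_cpow_mul_exp_neg_mul ht a r).le

/-- The Laplace transform of `t ^ (a - 1)` at a complex point `r` of the right half plane. -/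
lemma integral_cpow_mul_exp_neg_mul_of_re_pos {a r : ℂ} (ha : 0 < a.re) (hr : 0 < r.re) :
    ∫ t : ℝ in Set.Ioi 0, (t : ℂ) ^ (a - 1) * Complex.exp (-(r * t)) =
      r ^ (-a) * Complex.Gamma a := by
  have hopen : IsOpen {r : ℂ | 0 < r.re} := isOpen_lt continuous_const Complex.continuous_re
  have h1 : AnalyticOnNhd ℂ
      (fun r : ℂ => ∫ t : ℝ in Set.Ioi 0, (t : ℂ) ^ (a - 1) * Complex.exp (-(r * t)))
      {r : ℂ | 0 < r.re} := by
    refine DifferentiableOn.analyticOnNhd (fun r hr => ?_) hopen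
    rw [Set.mem_ofPred_eq] at hr
    refine DifferentiableAt.differentiableWithinAt ?_
    refine differentiableAt_integral_of_dominated (ε := r.re / 2) (by positivity)
      (bound := fun t => t ^ (a.re - 1) * Real.exp (-(r.re / 2 * t)))
      (fun z _ => aestronglyMeasurable_cpow_mul_exp_neg_mul a z)
      (ae_of_all _ fun t => by fun_prop) ?_
      (integrableOn_rpow_mul_exp_neg_mul (by linarith) (by positivity))
    filter_upwards [ae_restrict_mem measurableSet_Ioi] with t ht z hz
    rw [norm_cpow_mul_exp_neg_mul ht]
    have hz' : r.re / 2 ≤ z.re := by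
      have := (Complex.abs_re_le_norm (z - r)).trans_lt (mem_ball_iff_norm.1 hz)
      rw [Complex.sub_re, abs_lt] at this
      linarith
    have ht' : 0 < t := ht
    gcongr
  have h2 : AnalyticOnNhd ℂ (fun r : ℂ => r ^ (-a) * Complex.Gamma a) {r : ℂ | 0 < r.re} := by
    refine DifferentiableOn.analyticOnNhd (fun r hr => ?_) hopen
    refine DifferentiableAt.differentiableWithinAt ?_
    exact (differentiableAt_id.cpow_const (Or.inl hr)).mul_const _
  -- Both sides are holomorphic in r and agree at positive real r, by the classical Gamma integral;
  -- such points accumulate at 1.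
  refine h1.eqOn_of_preconnected_of_frequently_eq h2
    (convex_halfSpace_re_gt 0).isPreconnected (z₀ := 1) (by simp) ?_ hr
  have htend : Tendsto (fun x : ℝ => (x : ℂ)) (𝓝[≠] 1) (𝓝[≠] 1) :=
    tendsto_nhdsWithin_iff.2 ⟨(by simpa using
      (Complex.continuous_ofReal.tendsto (1 : ℝ)).mono_left nhdsWithin_le_nhds),
      eventually_of_mem self_mem_nhdsWithin fun x hx => by simpa using hx⟩
  refine htend.frequently (Eventually.frequently ?_)
  filter_upwards [nhdsWithin_le_nhds (lt_mem_nhds (zero_lt_one' ℝ))] with x hx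
  rw [Complex.integral_cpow_mul_exp_neg_mul_Ioi ha hx, one_div, Complex.inv_cpow, Complex.cpow_neg]
  rw [Complex.arg_ofReal_of_nonneg hx.le]
  exact Real.pi_pos.ne

/-- This is the Laplace transform above at r = 1 - it; its factor Γ(α) cancels the normalising
constant of the density. -/
lemma charFun_gammaMeasure {α : ℝ} (hα : 0 < α) (t : ℝ) :
    charFun (gammaMeasure α 1) t = (1 - t * Complex.I) ^ (-(α : ℂ)) := by
  rw [charFun_apply_real, gammaMeasure,
    integral_withDensity_eq_integral_toReal_smul (by unfold gammaPDF; fun_prop)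
      (ae_of_all _ fun x => by simp [gammaPDF])]
  have h : ∀ x : ℝ, (gammaPDF α 1 x).toReal • Complex.exp (t * x * Complex.I) =
      (Set.Ici (0 : ℝ)).indicator (fun x : ℝ => (Complex.Gamma α)⁻¹ *
        ((x : ℂ) ^ ((α : ℂ) - 1) * Complex.exp (-((1 - t * Complex.I) * x)))) x := by
    intro x
    rw [gammaPDF, ENNReal.toReal_ofReal (gammaPDFReal_nonneg hα one_pos x), gammaPDFReal]
    by_cases hx : 0 ≤ x
    · rw [if_pos hx, Set.indicator_of_mem (Set.mem_Ici.2 hx)]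
      rw [Complex.real_smul]
      push_cast [Complex.ofReal_cpow hx]
      rw [Complex.Gamma_ofReal, show -((1 - (t : ℂ) * Complex.I) * x) =
        -(1 * x) + t * x * Complex.I by ring, Complex.exp_add]
      simp
      ring
    · rw [if_neg hx, Set.indicator_of_notMem (by simpa using hx)]
      simp
  simp_rw [h]
  rw [integral_indicator measurableSet_Ici, integral_Ici_eq_integral_Ioi, integral_const_mul,
    integral_cpow_mul_exp_neg_mul_of_re_pos (by simpa) (by simp)]
  have : Complex.Gamma α ≠ 0 := Complex.Gamma_ne_zero_of_re_pos (by simpa)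
  field_simp

/-- The law of a difference of two independent gamma variables. -/
lemma exists_charFun_eq_one_add_sq_rpow {α : ℝ} (hα : 0 < α) (c : ℝ) :
    ∃ μ : Measure ℝ, IsProbabilityMeasure μ ∧
      ∀ t, charFun μ t = (((1 + (t / c) ^ 2)⁻¹ ^ α : ℝ) : ℂ) := by
  have := isProbabilityMeasure_gammaMeasure hα one_pos
  have p1 : IsProbabilityMeasure ((gammaMeasure α 1).map (c⁻¹ * ·)) :=
    Measure.isProbabilityMeasure_map (by fun_prop)
  have p2 : IsProbabilityMeasure ((gammaMeasure α 1).map (-c⁻¹ * ·)) :=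
    Measure.isProbabilityMeasure_map (by fun_prop)
  -- The law of (G - G')/c: its characteristic function is a product of conjugates, namely |1 -
  -- it/c|^{-2α}.
  refine ⟨(gammaMeasure α 1).map (c⁻¹ * ·) ∗ (gammaMeasure α 1).map (-c⁻¹ * ·), inferInstance,
    fun t => ?_⟩
  rw [charFun_conv, charFun_map_mul, charFun_map_mul, neg_mul, charFun_neg, Complex.mul_conj,
    charFun_gammaMeasure hα, Complex.normSq_eq_norm_sq]
  congr 1
  have hsq : ∀ N : ℝ, 0 ≤ N → (N ^ (-α)) ^ 2 = (N ^ 2)⁻¹ ^ α := fun N hN => by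
    rw [← Real.rpow_natCast, ← Real.rpow_natCast, ← Real.rpow_mul hN, Real.inv_rpow (by positivity),
      ← Real.rpow_mul hN, ← Real.rpow_neg hN]
    ring_nf
  rw [← Complex.ofReal_neg, Complex.norm_cpow_real, hsq _ (norm_nonneg _),
    ← Complex.normSq_eq_norm_sq]
  congr 2
  simp [Complex.normSq_apply]
  ring

lemma exists_charFun_eq_prod_rpow {α : ℝ} (hα : 0 < α) (c : ℕ → ℝ) (n : ℕ) :
    ∃ μ : Measure ℝ, IsProbabilityMeasure μ ∧
      ∀ t, charFun μ t = (((∏ j ∈ Finset.range n, (1 + (t / c j) ^ 2)⁻¹) ^ α : ℝ) : ℂ) := by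
  induction n with
  | zero => exact ⟨Measure.dirac 0, inferInstance, fun t => by simp [charFun_dirac]⟩
  | succ n ih =>
    obtain ⟨μ, hμ, h⟩ := ih
    obtain ⟨ν, hν, h'⟩ := exists_charFun_eq_one_add_sq_rpow hα (c n)
    refine ⟨μ ∗ ν, inferInstance, fun t => ?_⟩
    rw [charFun_conv, h, h', Finset.prod_range_succ, Real.mul_rpow
      (Finset.prod_nonneg fun j _ => by positivity) (by positivity), Complex.ofReal_mul]

end GammaLaw

/-! ### The density as an inverse Fourier transform, and its positivity. -/

section Density

/-- Fatou's lemma as an integrability criterion. -/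
lemma integrable_of_tendsto_of_integral_le {X : Type*} [MeasurableSpace X] {μ : Measure X}
    {f : ℕ → X → ℝ} {g : X → ℝ} {C : ℝ} (hf : ∀ n, Integrable (f n) μ) (hf0 : ∀ n x, 0 ≤ f n x)
    (hC : ∀ n, ∫ x, f n x ∂μ ≤ C) (hlim : ∀ x, Tendsto (fun n => f n x) atTop (𝓝 (g x))) :
    Integrable g μ := by
  refine ⟨aestronglyMeasurable_of_tendsto_ae atTop (fun n => (hf n).1) (ae_of_all _ hlim), ?_⟩
  rw [hasFiniteIntegral_iff_enorm]
  have h1 : ∀ x, ‖g x‖ₑ = liminf (fun n => ‖f n x‖ₑ) atTop := fun x =>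
    ((continuous_enorm.tendsto _).comp (hlim x)).liminf_eq.symm
  simp_rw [h1]
  refine (lintegral_liminf_le' fun n => (hf n).1.enorm).trans_lt ?_
  refine lt_of_le_of_lt ?_ (ENNReal.ofReal_lt_top (r := C))
  refine liminf_le_of_le (by isBoundedDefault) fun b hb => ?_
  obtain ⟨n, hn⟩ := hb.exists
  refine hn.trans ?_
  rw [← ofReal_integral_norm_eq_lintegral_enorm (hf n)]
  refine ENNReal.ofReal_le_ofReal ?_
  simpa only [Real.norm_of_nonneg (hf0 n _)] using hC n

lemma image_exp_neg_Ioi : (fun t : ℝ => Real.exp (-t)) '' Set.Ioi 0 = Set.Ioo 0 1 := by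
  ext y
  constructor
  · rintro ⟨t, ht, rfl⟩
    exact ⟨Real.exp_pos _, by simpa using ht⟩
  · rintro ⟨h0, h1⟩
    exact ⟨-Real.log y, by simpa using Real.log_neg h0 h1, by simp [Real.exp_log h0]⟩

lemma hasDerivAt_exp_neg (t : ℝ) :
    HasDerivAt (fun t : ℝ => Real.exp (-t)) (-Real.exp (-t)) t := by
  simpa using (hasDerivAt_neg t).exp

lemma injective_exp_neg : Function.Injective fun t : ℝ => Real.exp (-t) := fun _ _ h =>
  neg_injective (Real.exp_injective h)

variable {α : ℝ}

/-- Change of variables y = e^{-t}: the quotient ln y/(y² - 1) becomes e^t g(t)/2, and the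
exponentials cancel because -1 - (α-1) + α = 0. -/
lemma sinhDensityIntegrand_exp_neg (α x : ℝ) {t : ℝ} (ht : 0 < t) :
    |-Real.exp (-t)| • sinhDensityIntegrand α x (Real.exp (-t)) =
      (2 ^ α)⁻¹ * (Real.cos (x * t) * sinhQuot t ^ α) := by
  have hs := Real.sinh_pos_iff.2 ht
  have h1 : Real.log (Real.exp (-t)) / (Real.exp (-t) ^ 2 - 1) =
      Real.exp t * (sinhQuot t / 2) := by
    rw [sinhQuot_of_ne ht.ne', Real.log_exp]
    have h2 : Real.exp (-t) ^ 2 - 1 = -(2 * (Real.exp (-t) * Real.sinh t)) := by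
      rw [Real.sinh_eq]
      have : Real.exp (-t) * Real.exp t = 1 := by rw [← Real.exp_add]; simp
      linear_combination this
    rw [h2, Real.exp_neg]
    have := Real.exp_pos t
    field_simp
  rw [sinhDensityIntegrand, h1, Real.log_exp, abs_neg, abs_of_pos (Real.exp_pos _), smul_eq_mul,
    Real.mul_rpow (Real.exp_pos _).le (div_nonneg (sinhQuot_pos t).le zero_le_two),
    Real.div_rpow (sinhQuot_pos t).le zero_le_two, ← Real.exp_mul, ← Real.exp_mul]
  have h3 : Real.exp (-t) * Real.exp (-t * (α - 1)) * Real.exp (t * α) = 1 := by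
    rw [← Real.exp_add, ← Real.exp_add]
    ring_nf
    simp
  rw [mul_neg, Real.cos_neg]
  linear_combination (Real.cos (x * t) * (sinhQuot t ^ α / 2 ^ α)) * h3

lemma integrable_cos_mul_sinhQuot_rpow (hα : 0 < α) (x : ℝ) :
    Integrable fun t => Real.cos (x * t) * sinhQuot t ^ α :=
  (integrable_sinhQuot_rpow hα).bdd_mul (c := 1) (by fun_prop)
    (ae_of_all _ fun t => Real.abs_cos_le_one _)

lemma intervalIntegrable_sinhDensityIntegrand (hα : 0 < α) (x : ℝ) :
    IntervalIntegrable (sinhDensityIntegrand α x) volume 0 1 := by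
  rw [intervalIntegrable_iff_integrableOn_Ioo_of_le zero_le_one, ← image_exp_neg_Ioi,
    integrableOn_image_iff_integrableOn_abs_deriv_smul measurableSet_Ioi
      (fun t _ => (hasDerivAt_exp_neg t).hasDerivWithinAt) injective_exp_neg.injOn]
  exact IntegrableOn.congr_fun ((integrable_cos_mul_sinhQuot_rpow hα x).integrableOn.const_mul _)
    (fun t ht => (sinhDensityIntegrand_exp_neg α x ht).symm) measurableSet_Ioi

lemma sinhDensity_eq_integral_cos (α x : ℝ) :
    sinhDensity α x = (2 * Real.pi)⁻¹ * ∫ t : ℝ, Real.cos (x * t) * sinhQuot t ^ α := by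
  have h1 : ∫ y in (0 : ℝ)..1, sinhDensityIntegrand α x y =
      (2 ^ α)⁻¹ * ∫ t in Set.Ioi (0 : ℝ), Real.cos (x * t) * sinhQuot t ^ α := by
    rw [intervalIntegral.integral_of_le zero_le_one, integral_Ioc_eq_integral_Ioo,
      ← image_exp_neg_Ioi, integral_image_eq_integral_abs_deriv_smul measurableSet_Ioi
      (fun t _ => (hasDerivAt_exp_neg t).hasDerivWithinAt) injective_exp_neg.injOn,
      ← integral_const_mul]
    exact setIntegral_congr_fun measurableSet_Ioi fun t ht => sinhDensityIntegrand_exp_neg α x ht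
  have h2 := integral_comp_abs (f := fun t => Real.cos (x * t) * sinhQuot t ^ α)
  have h3 : ∀ t : ℝ, Real.cos (x * |t|) = Real.cos (x * t) := fun t => by
    rcases abs_choice t with h | h <;> simp [h]
  simp only [sinhQuot_abs, h3] at h2
  rw [sinhDensity, h1, h2]
  have := Real.rpow_pos_of_pos (zero_lt_two' ℝ) α
  have := Real.pi_pos
  field_simp

lemma integrable_cexp_mul_sinhQuot_rpow (hα : 0 < α) (x : ℝ) :
    Integrable fun t : ℝ => Complex.exp (Complex.I * x * t) * ((sinhQuot t ^ α : ℝ) : ℂ) :=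
  (integrable_sinhQuot_rpow hα).ofReal.bdd_mul (c := 1) (by fun_prop)
    (ae_of_all _ fun t => by simp [Complex.norm_exp])

lemma sinhDensity_eq_integral_cexp (hα : 0 < α) (x : ℝ) :
    (sinhDensity α x : ℂ) =
      (2 * Real.pi)⁻¹ * ∫ t : ℝ, Complex.exp (Complex.I * x * t) * ((sinhQuot t ^ α : ℝ) : ℂ) := by
  have h1 : ∫ t : ℝ, Complex.exp (Complex.I * (-x : ℝ) * t) * ((sinhQuot t ^ α : ℝ) : ℂ) =
      ∫ t : ℝ, Complex.exp (Complex.I * x * t) * ((sinhQuot t ^ α : ℝ) : ℂ) := by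
    rw [← integral_neg_eq_self]
    simp [sinhQuot_neg]
  have h2 := integral_add (integrable_cexp_mul_sinhQuot_rpow hα x)
    (integrable_cexp_mul_sinhQuot_rpow hα (-x))
  rw [h1] at h2
  have h3 : ∀ t : ℝ, Complex.exp (Complex.I * x * t) * ((sinhQuot t ^ α : ℝ) : ℂ) +
      Complex.exp (Complex.I * (-x : ℝ) * t) * ((sinhQuot t ^ α : ℝ) : ℂ) =
      ((2 * (Real.cos (x * t) * sinhQuot t ^ α) : ℝ) : ℂ) := fun t => by
    push_cast
    rw [Complex.cos]
    ring_nf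
  simp_rw [h3] at h2
  rw [integral_complex_ofReal, integral_const_mul] at h2
  rw [sinhDensity_eq_integral_cos]
  push_cast at h2 ⊢
  linear_combination (2 * (Real.pi : ℂ))⁻¹ / 2 * h2

lemma continuous_sinhDensity (hα : 0 < α) : Continuous (sinhDensity α) := by
  have : sinhDensity α = fun x => (2 * Real.pi)⁻¹ *
      ∫ t : ℝ, Real.cos (x * t) * sinhQuot t ^ α := funext fun x => sinhDensity_eq_integral_cos α x
  rw [this]
  refine continuous_const.mul (continuous_of_dominated (bound := fun t => sinhQuot t ^ α)
    (fun x => (integrable_cos_mul_sinhQuot_rpow hα x).1) (fun x => ae_of_all _ fun t => ?_)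
    (integrable_sinhQuot_rpow hα) (ae_of_all _ fun t => by fun_prop))
  rw [norm_mul, Real.norm_of_nonneg (sinhQuot_rpow_pos α t).le]
  exact mul_le_of_le_one_left (sinhQuot_rpow_pos α t).le (Real.abs_cos_le_one _)

/-- The Fourier transform of a Gaussian, with the value written as a real number. -/
lemma integral_cexp_mul_exp_neg_mul_sq {b : ℝ} (hb : 0 < b) (y : ℝ) :
    ∫ t : ℝ, Complex.exp (Complex.I * y * t) * (Real.exp (-b * t ^ 2) : ℂ) =
      ((Real.sqrt (Real.pi / b) * Real.exp (-y ^ 2 / (4 * b)) : ℝ) : ℂ) := by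
  have := fourierIntegral_gaussian (b := b) (by simpa) y
  push_cast
  rw [this, Real.sqrt_eq_rpow, Complex.ofReal_cpow (by positivity)]
  push_cast
  rfl

lemma integrable_cexp_mul_exp_neg_mul_sq {b : ℝ} (hb : 0 < b) (y : ℝ) :
    Integrable fun t : ℝ => Complex.exp (Complex.I * y * t) * (Real.exp (-b * t ^ 2) : ℂ) :=
  (integrable_exp_neg_mul_sq hb).ofReal.bdd_mul (c := 1) (by fun_prop)
    (ae_of_all _ fun t => by simp [Complex.norm_exp])

/-- The inverse Fourier transform of a characteristic function times a Gaussian is nonnegative. -/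
lemma re_integral_cexp_mul_gaussian_mul_charFun_nonneg (μ : Measure ℝ) [IsProbabilityMeasure μ]
    {b : ℝ} (hb : 0 < b) (x : ℝ) :
    0 ≤ (∫ t : ℝ, Complex.exp (Complex.I * x * t) * (Real.exp (-b * t ^ 2) : ℂ) *
      charFun μ t).re := by
  have h1 : ∀ t : ℝ, Complex.exp (Complex.I * x * t) * (Real.exp (-b * t ^ 2) : ℂ) * charFun μ t =
      ∫ y : ℝ, Complex.exp (Complex.I * x * t) * (Real.exp (-b * t ^ 2) : ℂ) *
        Complex.exp (t * y * Complex.I) ∂μ := fun t => by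
    rw [charFun_apply_real, integral_const_mul]
  simp_rw [h1]
  rw [integral_integral_swap]
  · have h2 : ∀ y : ℝ, ∫ t : ℝ, Complex.exp (Complex.I * x * t) * (Real.exp (-b * t ^ 2) : ℂ) *
        Complex.exp (t * y * Complex.I) =
        ((Real.sqrt (Real.pi / b) * Real.exp (-(x + y) ^ 2 / (4 * b)) : ℝ) : ℂ) := fun y => by
      rw [← integral_cexp_mul_exp_neg_mul_sq hb]
      refine integral_congr_ae (ae_of_all _ fun t => ?_)
      simp only
      rw [mul_right_comm, ← Complex.exp_add]
      push_cast
      ring_nf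
    simp_rw [h2]
    rw [integral_complex_ofReal, Complex.ofReal_re]
    exact integral_nonneg fun y => by positivity
  · have h3 : Integrable (fun p : ℝ × ℝ => (Real.exp (-b * p.1 ^ 2) : ℂ) * 1)
        (volume.prod μ) :=
      (integrable_exp_neg_mul_sq hb).ofReal.mul_prod (integrable_const (1 : ℂ))
    refine h3.norm.mono' (by fun_prop) (ae_of_all _ fun p => ?_)
    simp [Function.uncurry, Complex.norm_exp]

/-- Two dominated limits, with no weak limit of measures: first the partial Euler products tend to g
under a fixed Gaussian, then the Gaussian is removed. -/
lemma sinhDensity_nonneg (hα : 0 < α) (x : ℝ) : 0 ≤ sinhDensity α x := by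
  have h1 : ∀ b : ℝ, 0 < b → 0 ≤ (∫ t : ℝ, Complex.exp (Complex.I * x * t) *
      (Real.exp (-b * t ^ 2) : ℂ) * ((sinhQuot t ^ α : ℝ) : ℂ)).re := fun b hb => by
    -- The characteristic function of `μ n` is the α-th power of the n-th partial Euler product.
    choose μ hμ hchar using
      exists_charFun_eq_prod_rpow hα (fun j : ℕ => Real.pi * (j + 1))
    have hlim : Tendsto (fun n => ∫ t : ℝ, Complex.exp (Complex.I * x * t) *
        (Real.exp (-b * t ^ 2) : ℂ) * charFun (μ n) t) atTop
        (𝓝 (∫ t : ℝ, Complex.exp (Complex.I * x * t) *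
          (Real.exp (-b * t ^ 2) : ℂ) * ((sinhQuot t ^ α : ℝ) : ℂ))) := by
      refine tendsto_integral_of_dominated_convergence (fun t => Real.exp (-b * t ^ 2))
        (fun n => by fun_prop) (integrable_exp_neg_mul_sq hb)
        (fun n => ae_of_all _ fun t => ?_) (ae_of_all _ fun t => ?_)
      · rw [norm_mul, norm_mul]
        have := norm_charFun_le_one (μ := μ n) (t := t)
        rw [Complex.norm_real, Real.norm_of_nonneg (Real.exp_pos _).le]
        have h5 : ‖Complex.exp (Complex.I * x * t)‖ = 1 := by simp [Complex.norm_exp]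
        rw [h5, one_mul]
        exact mul_le_of_le_one_right (Real.exp_pos _).le this
      · refine Tendsto.const_mul _ ?_
        simp_rw [hchar]
        exact (Complex.continuous_ofReal.tendsto _).comp
          ((tendsto_prod_sinhQuot t).rpow_const (Or.inl (sinhQuot_pos t).ne'))
    exact ge_of_tendsto ((Complex.continuous_re.tendsto _).comp hlim)
      (Eventually.of_forall fun n => re_integral_cexp_mul_gaussian_mul_charFun_nonneg (μ n) hb x)
  -- The Gaussian parameter is b = 1/(n+1) → 0, with g^α itself as dominating function.
  have hlim : Tendsto (fun n : ℕ => ∫ t : ℝ, Complex.exp (Complex.I * x * t) *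
      (Real.exp (-(1 / ((n : ℝ) + 1)) * t ^ 2) : ℂ) * ((sinhQuot t ^ α : ℝ) : ℂ)) atTop
      (𝓝 (∫ t : ℝ, Complex.exp (Complex.I * x * t) * ((sinhQuot t ^ α : ℝ) : ℂ))) := by
    refine tendsto_integral_of_dominated_convergence (fun t => sinhQuot t ^ α)
      (fun n => ?_) (integrable_sinhQuot_rpow hα)
      (fun n => ae_of_all _ fun t => ?_) (ae_of_all _ fun t => ?_)
    · have := continuous_sinhQuot_rpow α
      exact Continuous.aestronglyMeasurable (by fun_prop)
    · have h5 : ‖Complex.exp (Complex.I * x * t)‖ = 1 := by simp [Complex.norm_exp]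
      rw [norm_mul, norm_mul, h5, one_mul, Complex.norm_real, Complex.norm_real,
        Real.norm_of_nonneg (Real.exp_pos _).le, Real.norm_of_nonneg (sinhQuot_rpow_pos α t).le]
      refine mul_le_of_le_one_left (sinhQuot_rpow_pos α t).le (Real.exp_le_one_iff.2 ?_)
      rw [neg_mul, neg_nonpos]
      positivity
    · refine Tendsto.mul_const _ ?_
      have h6 : Tendsto (fun n : ℕ => Real.exp (-(1 / ((n : ℝ) + 1)) * t ^ 2)) atTop (𝓝 1) := by
        have := ((tendsto_one_div_add_atTop_nhds_zero_nat (𝕜 := ℝ)).neg.mul_const (t ^ 2)).rexp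
        simpa using this
      have := ((Complex.continuous_ofReal.tendsto 1).comp h6).const_mul
        (Complex.exp (Complex.I * x * t))
      simpa [Function.comp_def] using this
  have h2 : 0 ≤ (∫ t : ℝ, Complex.exp (Complex.I * x * t) * ((sinhQuot t ^ α : ℝ) : ℂ)).re :=
    ge_of_tendsto ((Complex.continuous_re.tendsto _).comp hlim)
      (Eventually.of_forall fun n => h1 _ (by positivity))
  have h3 := congrArg Complex.re (sinhDensity_eq_integral_cexp hα x)
  rw [Complex.ofReal_re] at h3
  rw [h3, Complex.re_ofReal_mul]
  have := Real.pi_pos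
  positivity

end Density

/-! ### Integrability, characteristic function and second moment of the density. -/

section CharacteristicFunction

variable {α : ℝ}

/-- By Fubini the integral is the mean of g^α ≤ 1 against a centred Gaussian probability density in
t. The bound does not depend on b, as Fatou's lemma requires when b → 0. -/
lemma integral_sinhDensity_mul_gaussian_le (hα : 0 < α) {b : ℝ} (hb : 0 < b) :
    Integrable (fun x => sinhDensity α x * Real.exp (-b * x ^ 2)) ∧
      ∫ x, sinhDensity α x * Real.exp (-b * x ^ 2) ≤ 1 := by
  have hπ := Real.pi_pos
  have hF : Integrable (fun p : ℝ × ℝ => Real.exp (-b * p.1 ^ 2) *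
      (Real.cos (p.1 * p.2) * sinhQuot p.2 ^ α)) (volume.prod volume) := by
    have h := (integrable_exp_neg_mul_sq hb).mul_prod (integrable_sinhQuot_rpow hα)
    have hc : Continuous fun p : ℝ × ℝ => sinhQuot p.2 ^ α :=
      (continuous_sinhQuot_rpow α).comp continuous_snd
    refine h.mono' (Continuous.mul (by fun_prop) (Continuous.mul (by fun_prop)
      hc)).aestronglyMeasurable (ae_of_all _ fun p => ?_)
    rw [norm_mul, norm_mul, Real.norm_of_nonneg (Real.exp_pos _).le,
      Real.norm_of_nonneg (sinhQuot_rpow_pos α _).le]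
    gcongr
    exact mul_le_of_le_one_left (sinhQuot_rpow_pos α _).le (Real.abs_cos_le_one _)
  have h1 : ∀ x, sinhDensity α x * Real.exp (-b * x ^ 2) = (2 * Real.pi)⁻¹ *
      ∫ t : ℝ, Real.exp (-b * x ^ 2) * (Real.cos (x * t) * sinhQuot t ^ α) := fun x => by
    rw [sinhDensity_eq_integral_cos, integral_const_mul]
    ring
  simp_rw [h1]
  refine ⟨hF.integral_prod_left.const_mul _, ?_⟩
  rw [integral_const_mul, integral_integral_swap hF]
  have h2 : ∀ t : ℝ, ∫ x : ℝ, Real.exp (-b * x ^ 2) * (Real.cos (x * t) * sinhQuot t ^ α) =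
      Real.sqrt (Real.pi / b) * Real.exp (-(1 / (4 * b)) * t ^ 2) * sinhQuot t ^ α := fun t => by
    have h3 := congrArg Complex.re (integral_cexp_mul_exp_neg_mul_sq hb t)
    rw [Complex.ofReal_re, ← RCLike.re_eq_complex_re,
      ← integral_re (integrable_cexp_mul_exp_neg_mul_sq hb t)] at h3
    rw [show -(1 / (4 * b)) * t ^ 2 = -t ^ 2 / (4 * b) by ring, ← h3, ← integral_mul_const]
    refine integral_congr_ae (ae_of_all _ fun x => ?_)
    simp only [RCLike.re_eq_complex_re, Complex.re_mul_ofReal]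
    have : (Complex.exp (Complex.I * t * x)).re = Real.cos (x * t) := by
      rw [Complex.exp_re]
      simp [mul_comm]
    rw [this]
    ring
  simp_rw [h2]
  have hb4 : 0 < 1 / (4 * b) := by positivity
  have hg := (integrable_exp_neg_mul_sq hb4).const_mul (Real.sqrt (Real.pi / b))
  calc _ ≤ (2 * Real.pi)⁻¹ *
        ∫ t : ℝ, Real.sqrt (Real.pi / b) * Real.exp (-(1 / (4 * b)) * t ^ 2) := by
        refine mul_le_mul_of_nonneg_left ?_ (by positivity)
        refine integral_mono_of_nonneg (ae_of_all _ fun t => ?_) hg (ae_of_all _ fun t => ?_)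
        · have := sinhQuot_rpow_pos α t
          simp only [Pi.zero_apply]
          positivity
        · exact mul_le_of_le_one_right (by positivity) (sinhQuot_rpow_le_one hα t)
    _ = 1 := by
        rw [integral_const_mul, integral_gaussian, ← Real.sqrt_mul (by positivity)]
        rw [show Real.pi / b * (Real.pi / (1 / (4 * b))) = (2 * Real.pi) ^ 2 by field_simp; norm_num,
          Real.sqrt_sq (by positivity)]
        field_simp

lemma integrable_sinhDensity (hα : 0 < α) : Integrable (sinhDensity α) := by
  refine integrable_of_tendsto_of_integral_le
    (f := fun (n : ℕ) x => sinhDensity α x * Real.exp (-(1 / ((n : ℝ) + 1)) * x ^ 2)) (C := 1)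
    (fun n => (integral_sinhDensity_mul_gaussian_le hα (by positivity)).1)
    (fun n x => mul_nonneg (sinhDensity_nonneg hα x) (Real.exp_pos _).le)
    (fun n => (integral_sinhDensity_mul_gaussian_le hα (by positivity)).2) fun x => ?_
  have := (((tendsto_one_div_add_atTop_nhds_zero_nat (𝕜 := ℝ)).neg.mul_const (x ^ 2)).rexp).const_mul
    (sinhDensity α x)
  simpa using this

/-- The characteristic function of the hyperbolic sinh density, by Fourier inversion. -/
lemma integral_cexp_mul_sinhDensity (hα : 0 < α) (t : ℝ) :
    ∫ x : ℝ, Complex.exp (Complex.I * t * x) * (sinhDensity α x : ℂ) =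
      ((sinhQuot t ^ α : ℝ) : ℂ) := by
  have hπ := Real.pi_pos
  -- The kernel here is e^{-2πixw}, hence the argument -2πw; below, inversion is read at -t and the
  -- variable rescaled by -2π.
  have hF : FourierTransform.fourier (fun t : ℝ => ((sinhQuot t ^ α : ℝ) : ℂ)) =
      fun w : ℝ => ((2 * Real.pi * sinhDensity α (-2 * Real.pi * w) : ℝ) : ℂ) := by
    ext w
    rw [Real.fourier_eq']
    push_cast
    rw [sinhDensity_eq_integral_cexp hα]
    push_cast
    rw [← mul_assoc, mul_inv_cancel₀ (by simp [hπ.ne']), one_mul]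
    refine integral_congr_ae (ae_of_all _ fun x => ?_)
    simp only [smul_eq_mul, RCLike.inner_apply, conj_trivial]
    push_cast
    ring_nf
  have h2π : (-2 * Real.pi) ≠ 0 := by positivity
  have hint : Integrable (FourierTransform.fourier fun t : ℝ => ((sinhQuot t ^ α : ℝ) : ℂ)) := by
    rw [hF]
    exact (((integrable_sinhDensity hα).comp_mul_left' h2π).const_mul _).ofReal
  have hinv := congrFun (Continuous.fourierInv_fourier_eq
    (Complex.continuous_ofReal.comp (continuous_sinhQuot_rpow α))
    (integrable_sinhQuot_rpow hα).ofReal hint) (-t)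
  simp only [Function.comp_def] at hinv
  rw [hF, Real.fourierInv_eq', sinhQuot_neg] at hinv
  rw [← hinv]
  have hsub := Measure.integral_comp_mul_left
    (fun x : ℝ => Complex.exp (Complex.I * t * x) * (sinhDensity α x : ℂ)) (-2 * Real.pi)
  have habs : |(-2 * Real.pi)⁻¹| = (2 * Real.pi)⁻¹ := by
    rw [abs_inv, abs_mul, abs_of_pos hπ]
    norm_num
  rw [habs] at hsub
  rw [show (∫ x : ℝ, Complex.exp (Complex.I * t * x) * (sinhDensity α x : ℂ)) =
    (2 * Real.pi : ℝ) • (2 * Real.pi)⁻¹ • ∫ x : ℝ, Complex.exp (Complex.I * t * x) *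
      (sinhDensity α x : ℂ) by rw [smul_smul, mul_inv_cancel₀ (by positivity), one_smul], ← hsub,
    ← integral_smul]
  refine integral_congr_ae (ae_of_all _ fun x => ?_)
  simp only [smul_eq_mul, RCLike.inner_apply, conj_trivial, Complex.real_smul]
  push_cast
  ring_nf

lemma integral_sinhDensity (hα : 0 < α) : ∫ x, sinhDensity α x = 1 := by
  have := integral_cexp_mul_sinhDensity hα 0
  simp only [Complex.ofReal_zero, mul_zero, zero_mul, Complex.exp_zero, one_mul, sinhQuot_zero,
    Real.one_rpow, integral_complex_ofReal] at this
  exact_mod_cast this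

lemma integral_cos_mul_sinhDensity (hα : 0 < α) (t : ℝ) :
    ∫ x : ℝ, Real.cos (t * x) * sinhDensity α x = sinhQuot t ^ α := by
  have h := congrArg Complex.re (integral_cexp_mul_sinhDensity hα t)
  have hi : Integrable fun x : ℝ => Complex.exp (Complex.I * t * x) * (sinhDensity α x : ℂ) :=
    (integrable_sinhDensity hα).ofReal.bdd_mul (c := 1) (by fun_prop)
      (ae_of_all _ fun x => by simp [Complex.norm_exp])
  rw [Complex.ofReal_re, ← RCLike.re_eq_complex_re, ← integral_re hi] at h
  rw [← h]
  refine integral_congr_ae (ae_of_all _ fun x => ?_)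
  simp only [RCLike.re_eq_complex_re, Complex.re_mul_ofReal, Complex.exp_re]
  simp

/-- Fatou's lemma as t = 1/(n+1) → 0: 2(1 - cos tx)/t² tends to x², while its integral against φ_α
is 2(1 - g(t)^α)/t² ≤ α. -/
lemma integrable_sq_mul_sinhDensity (hα : 0 < α) :
    Integrable fun x => x ^ 2 * sinhDensity α x := by
  have hi : ∀ t : ℝ, Integrable fun x : ℝ => Real.cos (t * x) * sinhDensity α x := fun t =>
    (integrable_sinhDensity hα).bdd_mul (c := 1) (by fun_prop)
      (ae_of_all _ fun t => Real.abs_cos_le_one _)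
  have hi' : ∀ t : ℝ, Integrable fun x : ℝ => 2 / t ^ 2 *
      (sinhDensity α x - Real.cos (t * x) * sinhDensity α x) := fun t =>
    ((integrable_sinhDensity hα).sub (hi t)).const_mul _
  refine integrable_of_tendsto_of_integral_le
    (f := fun (n : ℕ) x => 2 / (1 / ((n : ℝ) + 1)) ^ 2 *
      (sinhDensity α x - Real.cos (1 / ((n : ℝ) + 1) * x) * sinhDensity α x)) (C := α)
    (fun n => hi' _) (fun n x => ?_) (fun n => ?_) fun x => ?_
  · refine mul_nonneg (by positivity) (sub_nonneg.2 ?_)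
    exact mul_le_of_le_one_left (sinhDensity_nonneg hα x) (Real.cos_le_one _)
  · generalize ht : 1 / ((n : ℝ) + 1) = t
    have ht0 : 0 < t := ht ▸ by positivity
    rw [integral_const_mul, integral_sub (integrable_sinhDensity hα) (hi t),
      integral_sinhDensity hα, integral_cos_mul_sinhDensity hα]
    calc _ ≤ 2 / t ^ 2 * (α * t ^ 2 / 2) := by gcongr; exact one_sub_sinhQuot_rpow_le hα t
      _ = α := by field_simp
  -- By 1 - cos(tx) = 2 sin²(tx/2); the sinc form extends continuously to t = 0, so the limit is a
  -- value.
  · have h1 : ∀ t : ℝ, t ≠ 0 → 2 / t ^ 2 * (sinhDensity α x - Real.cos (t * x) * sinhDensity α x) =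
        (x * Real.sinc (t * x / 2)) ^ 2 * sinhDensity α x := fun t ht => by
      rcases eq_or_ne x 0 with rfl | hx
      · simp
      · rw [Real.sinc_of_ne_zero (by positivity), show t * x = 2 * (t * x / 2) by ring,
          Real.cos_two_mul, Real.cos_sq']
        field_simp
        ring
    have h2 : Continuous fun t : ℝ => (x * Real.sinc (t * x / 2)) ^ 2 * sinhDensity α x := by
      have := Real.continuous_sinc
      fun_prop
    have h3 := (h2.tendsto 0).comp (tendsto_one_div_add_atTop_nhds_zero_nat (𝕜 := ℝ))
    simp only [zero_mul, zero_div, Real.sinc_zero, mul_one] at h3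
    refine h3.congr fun n => ?_
    rw [Function.comp, h1 _ (by positivity)]

end CharacteristicFunction

/-! ### The series as a Laplace-type integral and as a moment integral. -/

section Series

variable {α a : ℝ}

/-- The coefficient is α(α+1)⋯(α+n-1)/n!. Its sign lets the dominating series be summed in closed
form. -/
lemma ring_choose_add_sub_one_nonneg (hα : 0 < α) (n : ℕ) :
    0 ≤ Ring.choose ((n : ℝ) + α - 1) n := by
  rw [add_comm, ← Ring.multichoose_eq]
  have h := Ring.factorial_nsmul_multichoose_eq_ascPochhammer α n
  rw [Polynomial.ascPochhammer_smeval_eq_eval, nsmul_eq_mul] at h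
  have h1 := ascPochhammer_pos n α hα
  have h2 : (0 : ℝ) < n.factorial := by exact_mod_cast n.factorial_pos
  rw [← h] at h1
  exact (pos_of_mul_pos_right h1 h2.le).le

/-- The negative binomial series. -/
lemma hasSum_choose_mul_pow (α : ℝ) {x : ℝ} (hx : |x| < 1) :
    HasSum (fun n : ℕ => Ring.choose ((n : ℝ) + α - 1) n * x ^ n) (1 / (1 - x) ^ α) := by
  have h := (Real.one_div_one_sub_rpow_hasFPowerSeriesOnBall_zero α).hasSum (y := x)
    (by simpa [enorm_eq_nnnorm, ← NNReal.coe_lt_one] using hx)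
  simp only [FormalMultilinearSeries.ofScalars_apply_eq, zero_add, smul_eq_mul] at h
  simpa only [add_comm] using h

/-- From 2 sinh(u/2) = e^{u/2}(1 - e^{-u}). This ties the negative binomial generating function to
the characteristic function; the factor e^{-αu/2} is the origin of the shift a - α/2. -/
lemma sinhQuot_half_rpow (α : ℝ) {u : ℝ} (hu : 0 < u) :
    sinhQuot (u / 2) ^ α =
      u ^ α * Real.exp (-(α / 2 * u)) * (1 / (1 - Real.exp (-u)) ^ α) := by
  have hs : 0 < 1 - Real.exp (-u) := by simpa using hu
  have h : sinhQuot (u / 2) = u * Real.exp (-(u / 2)) / (1 - Real.exp (-u)) := by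
    have hs' := Real.sinh_pos_iff.2 (half_pos hu)
    rw [sinhQuot_of_ne (half_pos hu).ne', div_eq_div_iff hs'.ne' hs.ne', Real.sinh_eq]
    have h1 : Real.exp (-(u / 2)) * Real.exp (u / 2) = 1 := by rw [← Real.exp_add]; simp
    have h2 : Real.exp (-(u / 2)) * Real.exp (-(u / 2)) = Real.exp (-u) := by
      rw [← Real.exp_add]; ring_nf
    linear_combination (-u / 2) * h1 + u / 2 * h2
  rw [h, Real.div_rpow (by positivity) hs.le, Real.mul_rpow hu.le (Real.exp_pos _).le,
    ← Real.exp_mul]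
  ring_nf

lemma integrableOn_rpow_mul_exp_mul_sinhQuot (hα : 0 < α) {r b : ℝ} (hr : -1 < r) (hb : 0 < b) :
    IntegrableOn (fun u : ℝ => u ^ r * Real.exp (-(b * u)) * sinhQuot (u / 2) ^ α) (Set.Ioi 0) := by
  refine (integrableOn_rpow_mul_exp_neg_mul hr hb).mul_bdd (c := 1)
    ((continuous_sinhQuot_rpow α).comp (continuous_id.div_const 2)).aestronglyMeasurable
    (ae_of_all _ fun u => ?_)
  rw [Real.norm_of_nonneg (sinhQuot_rpow_pos α _).le]
  exact sinhQuot_rpow_le_one hα _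

/-- Termwise integration of the binomial expansion of the Laplace-type integral. -/
lemma hasSum_Gamma_mul_sinhMomentTerm (hα : 0 < α) (ha : α / 2 < a) {s : ℂ} (hs : α < s.re) :
    HasSum (fun n : ℕ => Complex.Gamma s * sinhMomentTerm α a s n)
      (∫ u : ℝ in Set.Ioi 0, (u : ℂ) ^ (s - α - 1) * Complex.exp (-(((a - α / 2 : ℝ) : ℂ) * u)) *
        ((sinhQuot (u / 2) ^ α : ℝ) : ℂ)) := by
  have ha0 : 0 < a := by linarith
  have hs0 : 0 < s.re := by linarith
  have hn : ∀ n : ℕ, 0 < (n : ℝ) + a := fun n => by positivity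
  set c : ℕ → ℝ := fun n => Ring.choose ((n : ℝ) + α - 1) n
  have hterm : ∀ n : ℕ, Complex.Gamma s * sinhMomentTerm α a s n =
      ∫ u : ℝ in Set.Ioi 0, (c n : ℂ) *
        ((u : ℂ) ^ (s - 1) * Complex.exp (-((((n : ℝ) + a : ℝ) : ℂ) * u))) := fun n => by
    rw [integral_const_mul, integral_cpow_mul_exp_neg_mul_of_re_pos hs0 (by simpa using hn n),
      Complex.cpow_neg, sinhMomentTerm, Complex.ofReal_add, Complex.ofReal_natCast]
    ring
  simp_rw [hterm]
  have hsumreal : ∀ u : ℝ, 0 < u → HasSum (fun n : ℕ => c n * Real.exp (-(((n : ℝ) + a) * u)))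
      (Real.exp (-(a * u)) * (1 / (1 - Real.exp (-u)) ^ α)) := fun u hu => by
    have h := (hasSum_choose_mul_pow α (x := Real.exp (-u))
      (by rw [abs_of_pos (Real.exp_pos _)]; simpa using hu)).mul_left (Real.exp (-(a * u)))
    refine h.congr_fun fun n => ?_
    rw [show -(((n : ℝ) + a) * u) = -(a * u) + n * (-u) by ring, Real.exp_add, Real.exp_nat_mul]
    ring
  have hid : ∀ u : ℝ, 0 < u → Real.exp (-(a * u)) * (1 / (1 - Real.exp (-u)) ^ α) =
      u ^ (-α) * Real.exp (-((a - α / 2) * u)) * sinhQuot (u / 2) ^ α := fun u hu => by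
    rw [sinhQuot_half_rpow α hu]
    have h1 : u ^ (-α) * u ^ α = 1 := by rw [← Real.rpow_add hu]; simp
    have h2 : Real.exp (-((a - α / 2) * u)) * Real.exp (-(α / 2 * u)) = Real.exp (-(a * u)) := by
      rw [← Real.exp_add]; ring_nf
    rw [← h2]
    linear_combination (-(Real.exp (-((a - α / 2) * u)) * Real.exp (-(α / 2 * u)) *
      (1 / (1 - Real.exp (-u)) ^ α))) * h1
  refine hasSum_integral_of_dominated_convergence
    (bound := fun n u => u ^ (s.re - 1) * (c n * Real.exp (-(((n : ℝ) + a) * u))))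
    (fun n => (aestronglyMeasurable_cpow_mul_exp_neg_mul s _).const_mul _) (fun n => ?_) ?_ ?_ ?_
  · filter_upwards [ae_restrict_mem measurableSet_Ioi] with u hu
    rw [norm_mul, norm_cpow_mul_exp_neg_mul hu, Complex.norm_real,
      Real.norm_of_nonneg (ring_choose_add_sub_one_nonneg hα n), Complex.ofReal_re]
    exact le_of_eq (by ring)
  · filter_upwards [ae_restrict_mem measurableSet_Ioi] with u hu
    exact (hsumreal u hu).summable.mul_left _
  -- The bounds sum to the limit function with s replaced by Re s; near 0 it behaves like u^{Re s -
  -- α - 1}, integrable because Re s > α.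
  · refine IntegrableOn.congr_fun (integrableOn_rpow_mul_exp_mul_sinhQuot hα (r := s.re - α - 1)
      (by linarith) (sub_pos.2 ha)) (fun u hu => ?_) measurableSet_Ioi
    have hu' : 0 < u := hu
    rw [((hsumreal u hu).mul_left _).tsum_eq, hid u hu,
      show s.re - α - 1 = (s.re - 1) + (-α) by ring, Real.rpow_add hu']
    ring
  · filter_upwards [ae_restrict_mem measurableSet_Ioi] with u hu
    have hu' : 0 < u := hu
    have h := (Complex.hasSum_ofReal.2 (hsumreal u hu)).mul_left ((u : ℂ) ^ (s - 1))
    rw [hid u hu] at h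
    have e : (u : ℂ) ^ (s - α - 1) * Complex.exp (-(((a - α / 2 : ℝ) : ℂ) * u)) *
        ((sinhQuot (u / 2) ^ α : ℝ) : ℂ) = (u : ℂ) ^ (s - 1) *
        ((u ^ (-α) * Real.exp (-((a - α / 2) * u)) * sinhQuot (u / 2) ^ α : ℝ) : ℂ) := by
      rw [show s - α - 1 = (s - 1) + ((-α : ℝ) : ℂ) by push_cast; ring,
        Complex.cpow_add _ _ (by exact_mod_cast hu'.ne'), ← Complex.ofReal_cpow hu'.le]
      push_cast
      ring
    rw [e]
    refine h.congr_fun fun n => ?_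
    push_cast
    ring

/-- Fubini and the Gamma integral turn the Laplace-type integral into the moment integral. -/
lemma integral_cpow_mul_exp_mul_sinhQuot (hα : 0 < α) (ha : α / 2 < a) {s : ℂ} (hs : α < s.re) :
    ∫ u : ℝ in Set.Ioi 0, (u : ℂ) ^ (s - α - 1) * Complex.exp (-(((a - α / 2 : ℝ) : ℂ) * u)) *
        ((sinhQuot (u / 2) ^ α : ℝ) : ℂ) =
      Complex.Gamma (s - α) * sinhMomentIntegral α a s := by
  have hre : 0 < (s - α).re := by simpa using hs
  -- The characteristic function is taken at -u/2, so that the exponentials merge into e^{-zu} with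
  -- z = a - α/2 + iy/2.
  have h1 : ∀ u : ℝ, (u : ℂ) ^ (s - α - 1) * Complex.exp (-(((a - α / 2 : ℝ) : ℂ) * u)) *
        ((sinhQuot (u / 2) ^ α : ℝ) : ℂ) =
      ∫ y : ℝ, (u : ℂ) ^ (s - α - 1) * Complex.exp (-(((a - α / 2 : ℝ) : ℂ) * u)) *
        (Complex.exp (Complex.I * (-(u / 2) : ℝ) * y) * (sinhDensity α y : ℂ)) := fun u => by
    rw [integral_const_mul, integral_cexp_mul_sinhDensity hα, sinhQuot_neg]
  simp_rw [h1]
  rw [integral_integral_swap]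
  · rw [sinhMomentIntegral, ← integral_const_mul]
    refine integral_congr_ae (ae_of_all _ fun y => ?_)
    simp only
    have hz : 0 < ((a : ℂ) - (α : ℂ) / 2 + 1 / 2 * Complex.I * (y : ℂ)).re := by
      simpa using ha
    have h2 : ∀ u : ℝ, (u : ℂ) ^ (s - α - 1) * Complex.exp (-(((a - α / 2 : ℝ) : ℂ) * u)) *
        (Complex.exp (Complex.I * (-(u / 2) : ℝ) * y) * (sinhDensity α y : ℂ)) =
        (u : ℂ) ^ (s - α - 1) * Complex.exp (-(((a : ℂ) - (α : ℂ) / 2 +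
          1 / 2 * Complex.I * (y : ℂ)) * u)) * (sinhDensity α y : ℂ) := fun u => by
      rw [← mul_assoc, mul_assoc _ (Complex.exp _) (Complex.exp _), ← Complex.exp_add]
      push_cast
      ring_nf
    simp_rw [h2]
    rw [integral_mul_const, integral_cpow_mul_exp_neg_mul_of_re_pos hre hz, Complex.cpow_neg]
    ring
  · have hi := (integrableOn_cpow_mul_exp_neg_mul hre
      (r := ((a - α / 2 : ℝ) : ℂ)) (by simpa using ha)).mul_prod ((integrable_sinhDensity hα).ofReal (𝕜 := ℂ))
    have hm : AEStronglyMeasurable (fun p : ℝ × ℝ => Complex.exp (Complex.I * (-(p.1 / 2) : ℝ) * p.2))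
        ((volume.restrict (Set.Ioi 0)).prod volume) :=
      Continuous.aestronglyMeasurable (by fun_prop)
    refine (hi.bdd_mul (c := 1) hm (ae_of_all _ fun p => ?_)).congr (ae_of_all _ fun p => ?_)
    · simp [Complex.norm_exp]
    · simp only [Function.uncurry, Complex.coe_algebraMap]
      ring

lemma summable_norm_sinhMomentTerm (hα : 0 < α) (ha : α / 2 < a) {s : ℂ} (hs : α < s.re) :
    Summable fun n : ℕ => ‖sinhMomentTerm α a s n‖ := by
  have hΓ : Complex.Gamma s ≠ 0 := Complex.Gamma_ne_zero_of_re_pos (hα.trans hs)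
  exact ((summable_mul_left_iff hΓ).1 (hasSum_Gamma_mul_sinhMomentTerm hα ha hs).summable).norm

lemma sinhMoment_eq (hα : 0 < α) (ha : α / 2 < a) {s : ℂ} (hs : α < s.re) :
    sinhMoment α a s = Complex.Gamma (s - α) / Complex.Gamma s * sinhMomentIntegral α a s := by
  have hΓ : Complex.Gamma s ≠ 0 := Complex.Gamma_ne_zero_of_re_pos (hα.trans hs)
  have h := (hasSum_Gamma_mul_sinhMomentTerm hα ha hs).tsum_eq
  rw [tsum_mul_left, integral_cpow_mul_exp_mul_sinhQuot hα ha hs] at h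
  rw [sinhMoment, div_mul_eq_mul_div, eq_div_iff hΓ, ← h, mul_comm]

end Series

/-! ### Analytic continuation, the pole at s = α, and expectations. -/

section Continuation

variable {α a : ℝ}

lemma one_div_cpow_eq_cpow_neg (z w : ℂ) : 1 / z ^ w = z ^ (-w) := by
  rw [one_div, Complex.cpow_neg]

lemma re_moment_base (α a y : ℝ) :
    ((a : ℂ) - (α : ℂ) / 2 + 1 / 2 * Complex.I * (y : ℂ)).re = a - α / 2 := by
  simp

lemma continuous_moment_base (α a : ℝ) :
    Continuous fun y : ℝ => (a : ℂ) - (α : ℂ) / 2 + 1 / 2 * Complex.I * (y : ℂ) := by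
  fun_prop

lemma continuous_one_div_moment_base_cpow (ha : α / 2 < a) (w : ℂ) :
    Continuous fun y : ℝ => 1 / ((a : ℂ) - (α : ℂ) / 2 + 1 / 2 * Complex.I * (y : ℂ)) ^ w := by
  simp_rw [one_div_cpow_eq_cpow_neg]
  exact (continuous_moment_base α a).cpow continuous_const fun y => Or.inl (by
    rw [re_moment_base]; linarith)

/-- A bound for the integrand of the moment integral, locally uniform in the exponent. -/
lemma norm_one_div_moment_base_cpow_le (ha : α / 2 < a) {w : ℂ} {R T : ℝ} (hR0 : 0 ≤ R) (h1 : -1 ≤ w.re)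
    (hR : w.re ≤ R) (hT : |w.im| ≤ T) (y : ℝ) :
    ‖1 / ((a : ℂ) - (α : ℂ) / 2 + 1 / 2 * Complex.I * (y : ℂ)) ^ w‖ ≤
      (a - α / 2 + 1 + y ^ 2 + (a - α / 2) ^ (-R)) * Real.exp (Real.pi * T) := by
  have hre := re_moment_base α a y
  set z := (a : ℂ) - (α : ℂ) / 2 + 1 / 2 * Complex.I * (y : ℂ) with hz
  set b := a - α / 2 with hb
  have hb0 : 0 < b := sub_pos.2 ha
  have hbz : b ≤ ‖z‖ := hre ▸ Complex.re_le_norm z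
  have hz0 : 0 < ‖z‖ := hb0.trans_le hbz
  have hzy : ‖z‖ ≤ b + 1 + y ^ 2 := by
    have e : z = (b : ℂ) + ((y / 2 : ℝ) : ℂ) * Complex.I := by
      rw [hz, hb]; push_cast; ring
    have h : ‖z‖ ≤ b + |y| / 2 := by
      rw [e]
      refine (norm_add_le _ _).trans_eq ?_
      rw [norm_mul, Complex.norm_I, Complex.norm_real, Complex.norm_real,
        Real.norm_of_nonneg hb0.le, Real.norm_eq_abs, abs_div]
      simp
    nlinarith [sq_abs y, sq_nonneg (|y| - 1)]
  -- If ‖z‖ ≥ 1, the exponent -Re w ≤ 1 gives at most ‖z‖; if ‖z‖ ≤ 1, the lower bound b ≤ ‖z‖ gives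
  -- at most b^{-R}.
  have hpow : ‖z‖ ^ (-w).re ≤ b + 1 + y ^ 2 + b ^ (-R) := by
    rw [Complex.neg_re]
    have hbR : 0 < b ^ (-R) := Real.rpow_pos_of_pos hb0 _
    rcases le_total 1 ‖z‖ with h | h
    · have : ‖z‖ ^ (-w.re) ≤ ‖z‖ := by
        simpa using Real.rpow_le_rpow_of_exponent_le h (show -w.re ≤ 1 by linarith)
      linarith
    · have h2 : ‖z‖ ^ (-w.re) ≤ b ^ (-R) := by
        refine (Real.rpow_le_rpow_of_exponent_ge hz0 h (neg_le_neg hR)).trans ?_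
        exact Real.rpow_le_rpow_of_nonpos hb0 hbz (by linarith)
      nlinarith [sq_nonneg y]
  rw [one_div_cpow_eq_cpow_neg]
  refine (Complex.norm_cpow_le z (-w)).trans ?_
  rw [div_eq_mul_inv, ← Real.exp_neg]
  have harg : -(z.arg * (-w).im) ≤ Real.pi * T := by
    rw [Complex.neg_im, mul_neg, neg_neg]
    calc _ ≤ |z.arg * w.im| := le_abs_self _
      _ = |z.arg| * |w.im| := abs_mul _ _
      _ ≤ _ := mul_le_mul (Complex.abs_arg_le_pi z) hT (abs_nonneg _) Real.pi_pos.le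
  have : 0 < b ^ (-R) := Real.rpow_pos_of_pos hb0 _
  gcongr

lemma integrable_moment_bound (hα : 0 < α) (c C : ℝ) :
    Integrable fun y => (c + y ^ 2) * C * sinhDensity α y := by
  have := (((integrable_sinhDensity hα).const_mul c).add
    (integrable_sq_mul_sinhDensity hα)).const_mul C
  refine this.congr (ae_of_all _ fun y => ?_)
  simp only [Pi.add_apply]
  ring

/-- The radius ε is the distance from s₀ to the line Re s = α - 1, so Re(s - α) ≥ -1 on the whole
ball and the second moment dominates. -/
lemma norm_momentIntegrand_le (hα : 0 < α) (ha : α / 2 < a) {s₀ : ℂ} {ε : ℝ}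
    (hε : ε = s₀.re - (α - 1)) {s : ℂ} (hs : s ∈ Metric.ball s₀ ε) (y : ℝ) :
    ‖1 / ((a : ℂ) - (α : ℂ) / 2 + 1 / 2 * Complex.I * (y : ℂ)) ^ (s - (α : ℂ)) *
        (sinhDensity α y : ℂ)‖ ≤
      (a - α / 2 + 1 + (a - α / 2) ^ (-(|s₀.re - α| + ε)) + y ^ 2) *
        Real.exp (Real.pi * (|s₀.im| + ε)) * sinhDensity α y := by
  have hε0 : 0 < ε := Metric.pos_of_mem_ball hs
  have hs' := mem_ball_iff_norm.1 hs
  have hre := abs_lt.1 ((Complex.abs_re_le_norm (s - s₀)).trans_lt hs')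
  have him := (Complex.abs_im_le_norm (s - s₀)).trans_lt hs'
  rw [Complex.sub_re] at hre
  rw [Complex.sub_im] at him
  rw [norm_mul, Complex.norm_real, Real.norm_of_nonneg (sinhDensity_nonneg hα y)]
  refine mul_le_mul_of_nonneg_right ?_ (sinhDensity_nonneg hα y)
  refine (norm_one_div_moment_base_cpow_le ha (R := |s₀.re - α| + ε) (T := |s₀.im| + ε)
    (by positivity) ?_ ?_ ?_ y).trans_eq (by ring)
  · rw [Complex.sub_re, Complex.ofReal_re]; linarith
  · rw [Complex.sub_re, Complex.ofReal_re]
    linarith [le_abs_self (s₀.re - α)]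
  · rw [Complex.sub_im, Complex.ofReal_im, sub_zero]
    have := abs_add_le (s.im - s₀.im) s₀.im
    rw [sub_add_cancel] at this
    linarith

lemma continuous_momentIntegrand (hα : 0 < α) (ha : α / 2 < a) (s : ℂ) :
    Continuous fun y : ℝ => 1 / ((a : ℂ) - (α : ℂ) / 2 + 1 / 2 * Complex.I * (y : ℂ)) ^
      (s - (α : ℂ)) * (sinhDensity α y : ℂ) :=
  (continuous_one_div_moment_base_cpow ha _).mul
    (Complex.continuous_ofReal.comp (continuous_sinhDensity hα))

lemma integrable_momentIntegrand (hα : 0 < α) (ha : α / 2 < a) {s : ℂ} (hs : α - 1 < s.re) :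
    Integrable fun y : ℝ => 1 / ((a : ℂ) - (α : ℂ) / 2 + 1 / 2 * Complex.I * (y : ℂ)) ^
      (s - (α : ℂ)) * (sinhDensity α y : ℂ) :=
  (integrable_moment_bound hα _ _).mono' (continuous_momentIntegrand hα ha s).aestronglyMeasurable
    (ae_of_all _ fun y => norm_momentIntegrand_le hα ha (s₀ := s) rfl
      (Metric.mem_ball_self (by linarith)) y)

lemma differentiableAt_sinhMomentIntegral (hα : 0 < α) (ha : α / 2 < a) {s : ℂ}
    (hs : α - 1 < s.re) : DifferentiableAt ℂ (sinhMomentIntegral α a) s := by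
  refine differentiableAt_integral_of_dominated (ε := s.re - (α - 1)) (by linarith)
    (fun z _ => (continuous_momentIntegrand hα ha z).aestronglyMeasurable)
    (ae_of_all _ fun y z _ => DifferentiableAt.differentiableWithinAt ?_)
    (ae_of_all _ fun y z hz => norm_momentIntegrand_le hα ha rfl hz y)
    (integrable_moment_bound hα _ _)
  have h0 : (a : ℂ) - (α : ℂ) / 2 + 1 / 2 * Complex.I * (y : ℂ) ≠ 0 := fun h => by
    have h1 := re_moment_base α a y
    rw [h, Complex.zero_re] at h1
    linarith
  simp_rw [one_div_cpow_eq_cpow_neg]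
  have h1 : DifferentiableAt ℂ (fun s : ℂ => -(s - (α : ℂ))) z := by fun_prop
  exact (h1.const_cpow (Or.inl h0)).mul_const _

lemma isOpen_re_gt (c : ℝ) : IsOpen {s : ℂ | c < s.re} :=
  isOpen_lt continuous_const Complex.continuous_re

lemma analyticOnNhd_sinhMomentIntegral (hα : 0 < α) (ha : α / 2 < a) {c : ℝ} (hc : α - 1 ≤ c) :
    AnalyticOnNhd ℂ (sinhMomentIntegral α a) {s : ℂ | c < s.re} :=
  DifferentiableOn.analyticOnNhd (fun _ hs => (differentiableAt_sinhMomentIntegral hα ha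
    (hc.trans_lt hs)).differentiableWithinAt) (isOpen_re_gt c)

lemma sinhMomentIntegral_self (hα : 0 < α) : sinhMomentIntegral α a α = 1 := by
  simp only [sinhMomentIntegral, sub_self, Complex.cpow_zero, div_one, one_mul]
  rw [integral_complex_ofReal, integral_sinhDensity hα, Complex.ofReal_one]

lemma isOpen_re_gt_and_ne (c : ℝ) (p : ℂ) : IsOpen {s : ℂ | c < s.re ∧ s ≠ p} :=
  (isOpen_re_gt c).inter isOpen_ne

/-- 1/Γ is entire, and Γ(s - α) has its poles at α - m: m = 0 is removed, and m ≥ 1 has real part at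
most α - 1 ≤ c. -/
lemma analyticOnNhd_extension (hα : 0 < α) (ha : α / 2 < a) {c : ℝ} (hc : α - 1 ≤ c) :
    AnalyticOnNhd ℂ
      (fun s => Complex.Gamma (s - (α : ℂ)) / Complex.Gamma s * sinhMomentIntegral α a s)
      {s : ℂ | c < s.re ∧ s ≠ (α : ℂ)} := by
  refine DifferentiableOn.analyticOnNhd (fun s hs => ?_) (isOpen_re_gt_and_ne c _)
  refine DifferentiableAt.differentiableWithinAt ?_
  simp_rw [div_eq_mul_inv]
  refine DifferentiableAt.mul (DifferentiableAt.mul ?_ Complex.differentiable_one_div_Gamma.differentiableAt)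
    (differentiableAt_sinhMomentIntegral hα ha (hc.trans_lt hs.1))
  refine DifferentiableAt.comp (g := Complex.Gamma) s
    (Complex.differentiableAt_Gamma _ fun m hm => ?_) (by fun_prop)
  rcases Nat.eq_zero_or_pos m with rfl | hm0
  · exact hs.2 (sub_eq_zero.1 (by simpa using hm))
  · have h := congrArg Complex.re hm
    rw [Complex.sub_re, Complex.ofReal_re, Complex.neg_re, Complex.natCast_re] at h
    have h1 : (1 : ℝ) ≤ m := by exact_mod_cast hm0
    linarith [hs.1]

/-- A half plane minus a real point is connected. -/
lemma isPreconnected_re_gt_and_ne {c p : ℝ} (hcp : c ≤ p) :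
    IsPreconnected {s : ℂ | c < s.re ∧ s ≠ (p : ℂ)} := by
  -- For c = ⌊α⌋ and p = α equality means that α is an integer; the point then lies on the boundary
  -- line and nothing is removed.
  rcases hcp.eq_or_lt with rfl | hcp
  · have : {s : ℂ | c < s.re ∧ s ≠ (c : ℂ)} = {s : ℂ | c < s.re} := by
      ext s
      refine ⟨fun h => h.1, fun h => ⟨h, ?_⟩⟩
      rintro rfl
      simp at h
    rw [this]
    exact (convex_halfSpace_re_gt c).isPreconnected
  have hR := (convex_halfSpace_re_gt p).isPreconnected
  have hL := ((convex_halfSpace_re_gt c).inter (convex_halfSpace_re_lt p)).isPreconnected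
  have hU := ((convex_halfSpace_re_gt c).inter (convex_halfSpace_im_gt 0)).isPreconnected
  have hD := ((convex_halfSpace_re_gt c).inter (convex_halfSpace_im_lt 0)).isPreconnected
  -- Four convex pieces, right of p, above the axis, below it, and the strip left of p, are glued at
  -- explicit common points.
  have h1 := IsPreconnected.union ((p + 1 : ℝ) + Complex.I) (by simp) (by simp; linarith) hR hU
  have h2 := IsPreconnected.union ((p + 1 : ℝ) - Complex.I) (by simp) (by simp; linarith) h1 hD
  have h3 := IsPreconnected.union (((c + p) / 2 : ℝ) + Complex.I)
    (Or.inl (Or.inr (by simp; linarith))) (by simp; constructor <;> linarith) h2 hL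
  convert h3 using 1
  ext s
  simp only [Set.mem_ofPred_eq, Set.mem_union, Set.mem_inter_iff, Complex.ext_iff, ne_eq,
    Complex.ofReal_re, Complex.ofReal_im]
  constructor
  · rintro ⟨h, h'⟩
    rcases lt_trichotomy s.im 0 with h4 | h4 | h4
    · tauto
    · rcases lt_trichotomy s.re p with h5 | h5 | h5 <;> tauto
    · tauto
  · rintro (((h | h) | h) | h)
    · exact ⟨hcp.trans h, fun h' => h.ne' h'.1⟩
    · exact ⟨h.1, fun h' => h.2.ne' h'.2⟩
    · exact ⟨h.1, fun h' => h.2.ne h'.2⟩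
    · exact ⟨h.1, fun h' => h.2.ne h'.1⟩

/-- The factor s - α turns Γ(s - α) into Γ(s - α + 1), which tends to 1, and at s = α the moment
integral is the total mass 1. -/
lemma tendsto_sub_mul_extension (hα : 0 < α) (ha : α / 2 < a) :
    Tendsto (fun s : ℂ => (s - (α : ℂ)) *
        (Complex.Gamma (s - (α : ℂ)) / Complex.Gamma s * sinhMomentIntegral α a s))
      (𝓝[≠] (α : ℂ)) (𝓝 (1 / Complex.Gamma (α : ℂ))) := by
  have hc : ContinuousAt (fun s : ℂ => Complex.Gamma (s - α + 1) * (Complex.Gamma s)⁻¹ *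
      sinhMomentIntegral α a s) α := by
    refine ContinuousAt.mul (ContinuousAt.mul ?_
      Complex.differentiable_one_div_Gamma.differentiableAt.continuousAt)
      (differentiableAt_sinhMomentIntegral hα ha (by simp)).continuousAt
    refine ContinuousAt.comp (g := Complex.Gamma) (DifferentiableAt.continuousAt
      (Complex.differentiableAt_Gamma _ fun m hm => ?_)) (by fun_prop)
    have h := congrArg Complex.re hm
    simp at h
    have h1 : (0 : ℝ) ≤ m := m.cast_nonneg
    linarith
  have h := hc.tendsto.mono_left (nhdsWithin_le_nhds (s := {(α : ℂ)}ᶜ))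
  simp only [sub_self, zero_add, Complex.Gamma_one, one_mul, sinhMomentIntegral_self hα,
    mul_one] at h
  rw [one_div]
  refine h.congr' ?_
  filter_upwards [self_mem_nhdsWithin] with s hs
  rw [Complex.Gamma_add_one _ (sub_ne_zero.2 hs)]
  ring

lemma isProbabilityMeasure_sinhLaw (hα : 0 < α) : IsProbabilityMeasure (sinhLaw α) := by
  refine ⟨?_⟩
  rw [sinhLaw, withDensity_apply _ MeasurableSet.univ, Measure.restrict_univ,
    ← ofReal_integral_eq_lintegral_ofReal (integrable_sinhDensity hα)
      (ae_of_all _ (sinhDensity_nonneg hα)), integral_sinhDensity hα, ENNReal.ofReal_one]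

lemma toReal_smul_moment_base_cpow (hα : 0 < α) (s : ℂ) (y : ℝ) :
    (ENNReal.ofReal (sinhDensity α y)).toReal •
        ((a : ℂ) - (α : ℂ) / 2 + 1 / 2 * Complex.I * (y : ℂ)) ^ ((α : ℂ) - s) =
      1 / ((a : ℂ) - (α : ℂ) / 2 + 1 / 2 * Complex.I * (y : ℂ)) ^ (s - (α : ℂ)) *
        (sinhDensity α y : ℂ) := by
  rw [ENNReal.toReal_ofReal (sinhDensity_nonneg hα y), one_div_cpow_eq_cpow_neg, neg_sub,
    Complex.real_smul, mul_comm]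

lemma measurable_ofReal_sinhDensity (hα : 0 < α) :
    Measurable fun y => ENNReal.ofReal (sinhDensity α y) :=
  (continuous_sinhDensity hα).measurable.ennreal_ofReal

lemma integrable_moment_base_cpow_sinhLaw (hα : 0 < α) (ha : α / 2 < a) {s : ℂ}
    (hs : α - 1 < s.re) :
    Integrable (fun y : ℝ => ((a : ℂ) - (α : ℂ) / 2 + 1 / 2 * Complex.I * (y : ℂ)) ^
      ((α : ℂ) - s)) (sinhLaw α) := by
  rw [sinhLaw, integrable_withDensity_iff_integrable_smul' (measurable_ofReal_sinhDensity hα)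
    (ae_of_all _ fun _ => ENNReal.ofReal_lt_top)]
  simp_rw [toReal_smul_moment_base_cpow hα]
  exact integrable_momentIntegrand hα ha hs

lemma sinhMomentIntegral_eq_integral_sinhLaw (hα : 0 < α) (s : ℂ) :
    sinhMomentIntegral α a s =
      ∫ y : ℝ, ((a : ℂ) - (α : ℂ) / 2 + 1 / 2 * Complex.I * (y : ℂ)) ^ ((α : ℂ) - s)
        ∂(sinhLaw α) := by
  rw [sinhLaw, integral_withDensity_eq_integral_toReal_smul (measurable_ofReal_sinhDensity hα)
    (ae_of_all _ fun _ => ENNReal.ofReal_lt_top)]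
  simp_rw [toReal_smul_moment_base_cpow hα]
  rfl

lemma HasLaw.integral_moment_base_cpow {Ω : Type*} [MeasurableSpace Ω] {P : Measure Ω}
    {X : Ω → ℝ} (hX : HasLaw X (sinhLaw α) P) (hα : 0 < α) (ha : α / 2 < a) {s : ℂ}
    (hs : α - 1 < s.re) :
    Integrable (fun ω => ((a : ℂ) - (α : ℂ) / 2 + 1 / 2 * Complex.I * (X ω : ℂ)) ^
        ((α : ℂ) - s)) P ∧
      sinhMomentIntegral α a s =
        ∫ ω, ((a : ℂ) - (α : ℂ) / 2 + 1 / 2 * Complex.I * (X ω : ℂ)) ^ ((α : ℂ) - s) ∂P := by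
  have hi := integrable_moment_base_cpow_sinhLaw hα ha hs
  rw [sinhMomentIntegral_eq_integral_sinhLaw hα, ← hX.integral_comp hi.1]
  refine ⟨?_, rfl⟩
  rw [← hX.map_eq] at hi
  exact hi.comp_aemeasurable hX.aemeasurable

end Continuation

theorem theorem3p2 (α a : ℝ) (hα : 0 < α) (ha : α / 2 < a) :
    -- `φ_α` is a well-defined probability density
    ((∀ x : ℝ, IntervalIntegrable (sinhDensityIntegrand α x) volume 0 1) ∧
      (∀ x : ℝ, 0 ≤ sinhDensity α x) ∧ Integrable (sinhDensity α) ∧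
      ∫ x : ℝ, sinhDensity α x = 1) ∧
    -- its Fourier transform (the value `1` at `t = 0` is the preceding line)
    (∀ t : ℝ, t ≠ 0 →
      ∫ x : ℝ, Complex.exp (Complex.I * (t : ℂ) * (x : ℂ)) * (sinhDensity α x : ℂ) =
        (((t / Real.sinh t) ^ α : ℝ) : ℂ)) ∧
    -- the series converges absolutely for `Re s > α` and has the integral representation
    (∀ s : ℂ, α < s.re →
      Summable (fun n : ℕ => ‖sinhMomentTerm α a s n‖) ∧
      sinhMoment α a s =
        Complex.Gamma (s - (α : ℂ)) / Complex.Gamma s * sinhMomentIntegral α a s) ∧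
    -- the same representation as an expectation; the expectation exists for `Re s > ⌊α⌋`
    (∀ (Ω : Type*) [MeasurableSpace Ω] (P : Measure Ω) (X : Ω → ℝ), HasLaw X (sinhLaw α) P →
      IsProbabilityMeasure P ∧
      (∀ s : ℂ, (⌊α⌋ : ℝ) < s.re →
        Integrable (fun ω => ((a : ℂ) - (α : ℂ) / 2 + 1 / 2 * Complex.I * (X ω : ℂ)) ^
          ((α : ℂ) - s)) P ∧
        sinhMomentIntegral α a s =
          ∫ ω, ((a : ℂ) - (α : ℂ) / 2 + 1 / 2 * Complex.I * (X ω : ℂ)) ^ ((α : ℂ) - s) ∂P) ∧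
      (∀ s : ℂ, α < s.re →
        sinhMoment α a s = Complex.Gamma (s - (α : ℂ)) / Complex.Gamma s *
          ∫ ω, ((a : ℂ) - (α : ℂ) / 2 + 1 / 2 * Complex.I * (X ω : ℂ)) ^ ((α : ℂ) - s) ∂P)) ∧
    -- analytic extension to `Re s > ⌊α⌋`, away from the pole `s = α` of `Γ(s - α)`
    AnalyticOnNhd ℂ (sinhMomentIntegral α a) {s : ℂ | (⌊α⌋ : ℝ) < s.re} ∧
    AnalyticOnNhd ℂ
      (fun s => Complex.Gamma (s - (α : ℂ)) / Complex.Gamma s * sinhMomentIntegral α a s)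
      {s : ℂ | (⌊α⌋ : ℝ) < s.re ∧ s ≠ (α : ℂ)} ∧
    (∀ F : ℂ → ℂ, AnalyticOnNhd ℂ F {s : ℂ | (⌊α⌋ : ℝ) < s.re ∧ s ≠ (α : ℂ)} →
      (∀ s : ℂ, α < s.re → F s = sinhMoment α a s) →
      ∀ s : ℂ, (⌊α⌋ : ℝ) < s.re → s ≠ (α : ℂ) →
        F s = Complex.Gamma (s - (α : ℂ)) / Complex.Gamma s * sinhMomentIntegral α a s) ∧
    -- the excluded point is a simple pole
    Tendsto (fun s : ℂ => (s - (α : ℂ)) *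
        (Complex.Gamma (s - (α : ℂ)) / Complex.Gamma s * sinhMomentIntegral α a s))
      (𝓝[≠] (α : ℂ)) (𝓝 (1 / Complex.Gamma (α : ℂ))) := by
  -- The only property of ⌊α⌋ that integrability and analyticity use: Re s > ⌊α⌋ forces Re s > α -
  -- 1.
  have hfloor : α - 1 ≤ (⌊α⌋ : ℝ) := (Int.sub_one_lt_floor α).le
  refine ⟨⟨intervalIntegrable_sinhDensityIntegrand hα, sinhDensity_nonneg hα,
    integrable_sinhDensity hα, integral_sinhDensity hα⟩, fun t ht => ?_, fun s hs =>
    ⟨summable_norm_sinhMomentTerm hα ha hs, sinhMoment_eq hα ha hs⟩, ?_,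
    analyticOnNhd_sinhMomentIntegral hα ha hfloor, analyticOnNhd_extension hα ha hfloor, ?_,
    tendsto_sub_mul_extension hα ha⟩
  · rw [integral_cexp_mul_sinhDensity hα, sinhQuot_of_ne ht]
  · intro Ω _ P X hX
    have := isProbabilityMeasure_sinhLaw hα
    refine ⟨hX.isProbabilityMeasure, fun s hs =>
      HasLaw.integral_moment_base_cpow hX hα ha (hfloor.trans_lt hs), fun s hs => ?_⟩
    rw [← (HasLaw.integral_moment_base_cpow hX hα ha (by linarith)).2]
    exact sinhMoment_eq hα ha hs
  · intro F hF hFS s hs hne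
    -- The base point α + 1 is interior to the half plane Re s > α, where both functions equal the
    -- series.
    refine hF.eqOn_of_preconnected_of_eventuallyEq (analyticOnNhd_extension hα ha hfloor)
      (isPreconnected_re_gt_and_ne (Int.floor_le α)) (z₀ := ((α + 1 : ℝ) : ℂ)) ⟨?_, ?_⟩ ?_ ⟨hs, hne⟩
    · rw [Complex.ofReal_re]
      linarith [Int.floor_le α]
    · exact fun h => by simpa using congrArg Complex.re h
    · filter_upwards [(isOpen_re_gt α).mem_nhds (show α < ((α + 1 : ℝ) : ℂ).re by simp)] with z hz
      rw [hFS z hz, sinhMoment_eq hα ha hz]
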